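/- **Setting.** We work in the intuitionistic logic of partial terms (LPT, also called $E^+$-logic): intuitionistic first-order predicate logic with equality in which $t\downarrow$ ("$t$ denotes") abbreviates $t=t$. Free variables denote (axiom $x=x$), quantifiers may be instantiated only at denoting terms (axioms $\forall x\,\varphi\wedge t\downarrow\;\to\varphi[t/x]$ and $\varphi[t/x]\wedge t\downarrow\;\to\exists x\,\varphi$), constants denote, and function symbols, relation symbols and equality are strict ($F(t_1,\dots,t_n)\downarrow\;\to t_i\downarrow$, $R(t_1,\dots,t_n)\to t_i\downarrow$, $s=t\to s\downarrow\wedge\, t\downarrow$) and respect equality. Write $s\simeq t$ for $(s\downarrow\vee\, t\downarrow)\to s=t$. The system $\mathsf{HAP}$ is the theory in this logic with constant $0$, a unary function symbol $S$, binary function symbols $+,\times,\cdot$ (application, associating to the left and written by juxtaposition), constants $\mathbf k,\mathbf s,\mathbf p,\mathbf p_0,\mathbf p_1,\mathbf{succ},\mathbf r$, equality as only relation, and the following axioms, where $x,y,z$ are variables: * $Sx\downarrow$, $x+y\downarrow$, $x\times y\downarrow$, $Sx=Sy\to x=y$, $0\neq Sx$, $x+0=x$, $x+Sy=S(x+y)$,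 $x\times 0=0$, $x\times Sy=(x\times y)+x$; * $\mathbf kxy=x$, $\mathbf sxy\downarrow$, $\mathbf sxyz\simeq xz(yz)$, $\mathbf p_0x\downarrow$, $\mathbf p_1x\downarrow$, $\mathbf p_0(\mathbf pxy)=x$, $\mathbf p_1(\mathbf pxy)=y$, $\mathbf p(\mathbf p_0x)(\mathbf p_1x)=x$, $\mathbf{succ}\,x=Sx$, $\mathbf rxy0=x$, $\mathbf rxy(Sz)\simeq yz(\mathbf rxyz)$; * induction $\varphi[0/x]\wedge\forall x\,(\varphi\to\varphi[Sx/x])\to\forall x\,\varphi$ for every formula $\varphi$ of the language. **Proposition.** Let $\psi(x,y)$ be a formula in the language of $\mathsf{HAP}$ with no free variables other than $x,y$. Let $\mathsf{HAP}_f$ be the extension of $\mathsf{HAP}$ obtained by adding a new unary function symbol $f$ (strict and respecting equality), the axioms $$\exists y\,\psi(x,y)\to f(x)\downarrow,\qquad f(x)\downarrow\;\to\psi(x,f(x)),$$ and the induction axioms for all formulas of the enlarged language. Then $\mathsf{HAP}_f$ is conservative over $\mathsf{HAP}$: for every formula $\varphi$ in the language of $\mathsf{HAP}$, $\mathsf{HAP}_f\vdash\varphi$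 if and only if $\mathsf{HAP}\vdash\varphi$. -/

import Mathlib

open scoped FirstOrder

namespace LPT

universe u v u' v'

/-! ## The logic of partial terms (intuitionistic predicate logic, free variables denote)

Terms are Mathlib's first-order terms.  Formulas are intuitionistic, with all connectives
primitive, and well scoped: `Formula L n` has its free variables among `n` variables, indexed by
`Fin n`.  A quantifier binds the variable with index `0` and shifts the others by one. -/

/-- Terms of `L` whose variables are among `n` variables. -/
abbrev Tm (L : FirstOrder.Language.{u, v}) (n : ℕ) : Type u := L.Term (Fin n)

/-- Formulas of `L` whose free variables are among `n` variables. -/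
inductive Formula (L : FirstOrder.Language.{u, v}) : ℕ → Type (max u v)
  | bot {n : ℕ} : Formula L n
  | equal {n : ℕ} (t₁ t₂ : Tm L n) : Formula L n
  | rel {n k : ℕ} (R : L.Relations k) (ts : Fin k → Tm L n) : Formula L n
  | and {n : ℕ} (φ ψ : Formula L n) : Formula L n
  | or {n : ℕ} (φ ψ : Formula L n) : Formula L n
  | imp {n : ℕ} (φ ψ : Formula L n) : Formula L n
  | all {n : ℕ} (φ : Formula L (n + 1)) : Formula L n
  | ex {n : ℕ} (φ : Formula L (n + 1)) : Formula L n

infix:88 " =ₚ " => Formula.equal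
infixr:75 " ∧ₚ " => Formula.and
infixr:70 " ∨ₚ " => Formula.or
infixr:65 " →ₚ " => Formula.imp

/-- The variable with index `i`, as a term. -/
abbrev vr {L : FirstOrder.Language.{u, v}} {n : ℕ} (i : Fin n) : Tm L n :=
  FirstOrder.Language.Term.var i

/-- Extend a simultaneous substitution under a binder. -/
def liftSubst {L : FirstOrder.Language.{u, v}} {n m : ℕ} (σ : Fin n → Tm L m) :
    Fin (n + 1) → Tm L (m + 1) :=
  Fin.cons (vr 0) (fun i => (σ i).relabel Fin.succ)

namespace Formula

variable {L : FirstOrder.Language.{u, v}} {L' : FirstOrder.Language.{u', v'}}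

/-- Capture-avoiding simultaneous substitution. -/
def subst : {n m : ℕ} → Formula L n → (Fin n → Tm L m) → Formula L m
  | _, _, bot, _ => bot
  | _, _, equal t₁ t₂, σ => equal (t₁.subst σ) (t₂.subst σ)
  | _, _, rel R ts, σ => rel R (fun i => (ts i).subst σ)
  | _, _, and φ ψ, σ => and (φ.subst σ) (ψ.subst σ)
  | _, _, or φ ψ, σ => or (φ.subst σ) (ψ.subst σ)
  | _, _, imp φ ψ, σ => imp (φ.subst σ) (ψ.subst σ)
  | _, _, all φ, σ => all (φ.subst (liftSubst σ))
  | _, _, ex φ, σ => ex (φ.subst (liftSubst σ))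

/-- `φ` seen as a formula with one more variable (index `0`), which is not free in it. -/
def shift {n : ℕ} (φ : Formula L n) : Formula L (n + 1) :=
  φ.subst (fun i => vr i.succ)

/-- `φ[t/x]`, where `x` is the variable with index `0`. -/
def inst {n : ℕ} (φ : Formula L (n + 1)) (t : Tm L n) : Formula L n :=
  φ.subst (Fin.cons t vr)

/-- Translation of formulas along a morphism of languages. -/
def mapLang (ι : L →ᴸ L') : {n : ℕ} → Formula L n → Formula L' n
  | _, bot => bot
  | _, equal t₁ t₂ => equal (ι.onTerm t₁) (ι.onTerm t₂)
  | _, rel R ts => rel (ι.onRelation R) (fun i => ι.onTerm (ts i))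
  | _, and φ ψ => and (φ.mapLang ι) (ψ.mapLang ι)
  | _, or φ ψ => or (φ.mapLang ι) (ψ.mapLang ι)
  | _, imp φ ψ => imp (φ.mapLang ι) (ψ.mapLang ι)
  | _, all φ => all (φ.mapLang ι)
  | _, ex φ => ex (φ.mapLang ι)

/-- The finite conjunction `φ 0 ∧ ... ∧ φ (k - 1)` (for `k = 0` the true formula `⊥ → ⊥`). -/
def conj {n : ℕ} : {k : ℕ} → (Fin k → Formula L n) → Formula L n
  | 0, _ => bot →ₚ bot
  | _ + 1, φ => φ 0 ∧ₚ conj (fun i => φ i.succ)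

end Formula

/-- `t ↓` ("`t` denotes") abbreviates `t = t`. -/
def den {L : FirstOrder.Language.{u, v}} {n : ℕ} (t : Tm L n) : Formula L n := t =ₚ t

postfix:max " ↓ₚ" => den

/-- `s ≃ t`: if one of `s`, `t` denotes, then both do and they are equal. -/
def simeq {L : FirstOrder.Language.{u, v}} {n : ℕ} (s t : Tm L n) : Formula L n :=
  (s ↓ₚ ∨ₚ t ↓ₚ) →ₚ (s =ₚ t)

infix:88 " ≃ₚ " => simeq

/-- A set of (possibly open) nonlogical axioms. -/
abbrev Axioms (L : FirstOrder.Language.{u, v}) : Type (max u v) := ∀ n : ℕ, Set (Formula L n)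

open Formula in
/-- `Prf T φ`: the formula `φ` is derivable from the nonlogical axioms `T` in the logic of partial
terms.  A derivable formula with free variables is implicitly universally quantified. -/
inductive Prf {L : FirstOrder.Language.{u, v}} (T : Axioms L) : {n : ℕ} → Formula L n → Prop
  | ax {n : ℕ} {φ : Formula L n} : φ ∈ T n → Prf T φ
  -- propositional logic
  | id {n : ℕ} (φ : Formula L n) : Prf T (φ →ₚ φ)
  | mp {n : ℕ} {φ ψ : Formula L n} : Prf T φ → Prf T (φ →ₚ ψ) → Prf T ψ
  | trans {n : ℕ} {φ ψ χ : Formula L n} :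
      Prf T (φ →ₚ ψ) → Prf T (ψ →ₚ χ) → Prf T (φ →ₚ χ)
  | and_left {n : ℕ} (φ ψ : Formula L n) : Prf T (φ ∧ₚ ψ →ₚ φ)
  | and_right {n : ℕ} (φ ψ : Formula L n) : Prf T (φ ∧ₚ ψ →ₚ ψ)
  | and_intro {n : ℕ} {φ ψ χ : Formula L n} :
      Prf T (φ →ₚ ψ) → Prf T (φ →ₚ χ) → Prf T (φ →ₚ ψ ∧ₚ χ)
  | or_left {n : ℕ} (φ ψ : Formula L n) : Prf T (φ →ₚ φ ∨ₚ ψ)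
  | or_right {n : ℕ} (φ ψ : Formula L n) : Prf T (ψ →ₚ φ ∨ₚ ψ)
  | or_elim {n : ℕ} {φ ψ χ : Formula L n} :
      Prf T (φ →ₚ χ) → Prf T (ψ →ₚ χ) → Prf T (φ ∨ₚ ψ →ₚ χ)
  | curry {n : ℕ} {φ ψ χ : Formula L n} : Prf T (φ ∧ₚ ψ →ₚ χ) → Prf T (φ →ₚ ψ →ₚ χ)
  | uncurry {n : ℕ} {φ ψ χ : Formula L n} : Prf T (φ →ₚ ψ →ₚ χ) → Prf T (φ ∧ₚ ψ →ₚ χ)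
  | bot_elim {n : ℕ} (φ : Formula L n) : Prf T (bot →ₚ φ)
  -- quantifiers
  | all_intro {n : ℕ} {φ : Formula L n} {ψ : Formula L (n + 1)} :
      Prf T (φ.shift →ₚ ψ) → Prf T (φ →ₚ all ψ)
  | all_elim {n : ℕ} (φ : Formula L (n + 1)) (t : Tm L n) :
      Prf T (all φ ∧ₚ t ↓ₚ →ₚ φ.inst t)
  | ex_intro {n : ℕ} (φ : Formula L (n + 1)) (t : Tm L n) :
      Prf T (φ.inst t ∧ₚ t ↓ₚ →ₚ ex φ)
  | ex_elim {n : ℕ} {φ : Formula L (n + 1)} {ψ : Formula L n} :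
      Prf T (φ →ₚ ψ.shift) → Prf T (ex φ →ₚ ψ)
  -- equality, for variables; the first axiom says that variables denote
  | eq_refl {n : ℕ} (x : Fin n) : Prf T (vr x =ₚ vr x)
  | eq_symm {n : ℕ} (x y : Fin n) : Prf T (vr x =ₚ vr y →ₚ vr y =ₚ vr x)
  | eq_trans {n : ℕ} (x y z : Fin n) :
      Prf T (vr x =ₚ vr y ∧ₚ vr y =ₚ vr z →ₚ vr x =ₚ vr z)
  | eq_func {n k : ℕ} (F : L.Functions k) (x y : Fin k → Fin n) :
      Prf T (conj (fun i => vr (x i) =ₚ vr (y i)) ∧ₚ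
          (FirstOrder.Language.Term.func F fun i => vr (x i)) ↓ₚ →ₚ
        (FirstOrder.Language.Term.func F fun i => vr (x i)) =ₚ
          (FirstOrder.Language.Term.func F fun i => vr (y i)))
  | eq_rel {n k : ℕ} (R : L.Relations k) (x y : Fin k → Fin n) :
      Prf T (rel R (fun i => vr (x i)) ∧ₚ conj (fun i => vr (x i) =ₚ vr (y i)) →ₚ
        rel R (fun i => vr (y i)))
  -- strictness
  | const_den {n : ℕ} (c : L.Functions 0) (ts : Fin 0 → Tm L n) :
      Prf T (FirstOrder.Language.Term.func c ts) ↓ₚ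
  | func_strict {n k : ℕ} (F : L.Functions k) (ts : Fin k → Tm L n) (i : Fin k) :
      Prf T ((FirstOrder.Language.Term.func F ts) ↓ₚ →ₚ (ts i) ↓ₚ)
  | rel_strict {n k : ℕ} (R : L.Relations k) (ts : Fin k → Tm L n) (i : Fin k) :
      Prf T (rel R ts →ₚ (ts i) ↓ₚ)
  | eq_strict {n : ℕ} (s t : Tm L n) : Prf T (s =ₚ t →ₚ s ↓ₚ ∧ₚ t ↓ₚ)

/-- The induction axiom `χ[0/x] ∧ ∀ x, (χ → χ[Sx/x]) → ∀ x, χ` for the formula `χ` (whose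
variable `x` has index `0`; the other free variables of `χ` are parameters). -/
def inductionAxiom {L : FirstOrder.Language.{u, v}} (zero : L.Functions 0)
    (succ : L.Functions 1) {n : ℕ}
    (χ : Formula L (n + 1)) : Formula L n :=
  χ.inst (FirstOrder.Language.Constants.term zero) ∧ₚ
      Formula.all (χ →ₚ χ.subst (Fin.cons (succ.apply₁ (vr 0)) fun i => vr i.succ)) →ₚ
    Formula.all χ

end LPT

open LPT

/-! ## The system HAP -/

/-- The function symbols of HAP: arithmetical operations, application, and combinators. -/
inductive HAPFunc : ℕ → Type
  | zero : HAPFunc 0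
  | succ : HAPFunc 1
  | add : HAPFunc 2
  | mul : HAPFunc 2
  | app : HAPFunc 2
  | k : HAPFunc 0
  | s : HAPFunc 0
  | p : HAPFunc 0
  | p₀ : HAPFunc 0
  | p₁ : HAPFunc 0
  | sc : HAPFunc 0
  | r : HAPFunc 0

/-- The language of HAP; equality is its only relation. -/
def langHAP : FirstOrder.Language.{0, 0} := ⟨HAPFunc, fun _ => Empty⟩

namespace HAP

/-- The constant term given by a nullary symbol. -/
def cst {n : ℕ} (c : HAPFunc 0) : Tm langHAP n :=
  FirstOrder.Language.Constants.term (L := langHAP) c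

abbrev zero {n : ℕ} : Tm langHAP n := cst .zero
abbrev k {n : ℕ} : Tm langHAP n := cst .k
abbrev s {n : ℕ} : Tm langHAP n := cst .s
abbrev p {n : ℕ} : Tm langHAP n := cst .p
abbrev p₀ {n : ℕ} : Tm langHAP n := cst .p₀
abbrev p₁ {n : ℕ} : Tm langHAP n := cst .p₁
/-- The combinator **succ** representing the successor operation. -/
abbrev sc {n : ℕ} : Tm langHAP n := cst .sc
abbrev r {n : ℕ} : Tm langHAP n := cst .r

/-- The successor operation on terms. -/
def S {n : ℕ} (t : Tm langHAP n) : Tm langHAP n :=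
  FirstOrder.Language.Functions.apply₁ (L := langHAP) HAPFunc.succ t

def add {n : ℕ} (t u : Tm langHAP n) : Tm langHAP n :=
  FirstOrder.Language.Functions.apply₂ (L := langHAP) HAPFunc.add t u

def mul {n : ℕ} (t u : Tm langHAP n) : Tm langHAP n :=
  FirstOrder.Language.Functions.apply₂ (L := langHAP) HAPFunc.mul t u

def app {n : ℕ} (t u : Tm langHAP n) : Tm langHAP n :=
  FirstOrder.Language.Functions.apply₂ (L := langHAP) HAPFunc.app t u

infixl:100 " ·ₚ " => HAP.app
infixl:95 " +ₚ " => HAP.add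
infixl:97 " ×ₚ " => HAP.mul

/-- The axioms of HAP other than induction (`x`, `y`, `z` are variables). -/
inductive Basic : {n : ℕ} → Formula langHAP n → Prop
  -- arithmetic
  | succ_den {n : ℕ} (x : Fin n) : Basic (S (vr x)) ↓ₚ
  | add_den {n : ℕ} (x y : Fin n) : Basic (vr x +ₚ vr y) ↓ₚ
  | mul_den {n : ℕ} (x y : Fin n) : Basic (vr x ×ₚ vr y) ↓ₚ
  | succ_inj {n : ℕ} (x y : Fin n) : Basic (S (vr x) =ₚ S (vr y) →ₚ vr x =ₚ vr y)
  | zero_ne_succ {n : ℕ} (x : Fin n) : Basic (zero =ₚ S (vr x) →ₚ Formula.bot)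
  | add_zero {n : ℕ} (x : Fin n) : Basic (vr x +ₚ zero =ₚ vr x)
  | add_succ {n : ℕ} (x y : Fin n) : Basic (vr x +ₚ S (vr y) =ₚ S (vr x +ₚ vr y))
  | mul_zero {n : ℕ} (x : Fin n) : Basic (vr x ×ₚ zero =ₚ zero)
  | mul_succ {n : ℕ} (x y : Fin n) : Basic (vr x ×ₚ S (vr y) =ₚ vr x ×ₚ vr y +ₚ vr x)
  -- combinators
  | k_eq {n : ℕ} (x y : Fin n) : Basic (k ·ₚ vr x ·ₚ vr y =ₚ vr x)
  | s_den {n : ℕ} (x y : Fin n) : Basic (s ·ₚ vr x ·ₚ vr y) ↓ₚ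
  | s_eq {n : ℕ} (x y z : Fin n) :
      Basic (s ·ₚ vr x ·ₚ vr y ·ₚ vr z ≃ₚ vr x ·ₚ vr z ·ₚ (vr y ·ₚ vr z))
  | p₀_den {n : ℕ} (x : Fin n) : Basic (p₀ ·ₚ vr x) ↓ₚ
  | p₁_den {n : ℕ} (x : Fin n) : Basic (p₁ ·ₚ vr x) ↓ₚ
  | p₀_eq {n : ℕ} (x y : Fin n) : Basic (p₀ ·ₚ (p ·ₚ vr x ·ₚ vr y) =ₚ vr x)
  | p₁_eq {n : ℕ} (x y : Fin n) : Basic (p₁ ·ₚ (p ·ₚ vr x ·ₚ vr y) =ₚ vr y)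
  | p_eta {n : ℕ} (x : Fin n) : Basic (p ·ₚ (p₀ ·ₚ vr x) ·ₚ (p₁ ·ₚ vr x) =ₚ vr x)
  | sc_eq {n : ℕ} (x : Fin n) : Basic (sc ·ₚ vr x =ₚ S (vr x))
  | r_zero {n : ℕ} (x y : Fin n) : Basic (r ·ₚ vr x ·ₚ vr y ·ₚ zero =ₚ vr x)
  | r_succ {n : ℕ} (x y z : Fin n) :
      Basic (r ·ₚ vr x ·ₚ vr y ·ₚ S (vr z) ≃ₚ
        vr y ·ₚ vr z ·ₚ (r ·ₚ vr x ·ₚ vr y ·ₚ vr z))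

end HAP

/-- The axioms of the system HAP: the basic axioms, and induction for all formulas of its
language. -/
inductive HAPAx : {n : ℕ} → Formula langHAP n → Prop
  | basic {n : ℕ} {φ : Formula langHAP n} : HAP.Basic φ → HAPAx φ
  | ind {n : ℕ} (χ : Formula langHAP (n + 1)) :
      HAPAx (inductionAxiom (L := langHAP) HAPFunc.zero HAPFunc.succ χ)

/-- The system HAP. -/
def HAP : Axioms langHAP := fun _ => {φ | HAPAx φ}

/-! ## The extension of HAP by a function symbol -/

/-- A single unary function symbol `f`. -/
inductive FFunc : ℕ → Type
  | f : FFunc 1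

/-- The language with the unary function symbol `f` only. -/
def langF : FirstOrder.Language.{0, 0} := ⟨FFunc, fun _ => Empty⟩

/-- The language of HAP together with the unary function symbol `f`. -/
abbrev langHAPf : FirstOrder.Language.{0, 0} := langHAP.sum langF

/-- A formula of HAP, seen as a formula of the larger language. -/
def toF {n : ℕ} (φ : Formula langHAP n) : Formula langHAPf n :=
  φ.mapLang (FirstOrder.Language.LHom.sumInl : langHAP →ᴸ langHAPf)

/-- The term `f(t)`. -/
def fTm {n : ℕ} (t : Tm langHAPf n) : Tm langHAPf n :=
  FirstOrder.Language.Functions.apply₁ (L := langHAPf) (Sum.inr FFunc.f) t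

/-- The axioms of the extension of HAP with a unary function symbol `f` choosing, wherever
possible, a value `y` such that `ψ(x, y)`.  In `ψ`, the variable `x` has index `0` and the variable
`y` has index `1`, and there are no other free variables.  Induction is available for all formulas
of the larger language. -/
inductive HAPfAx (ψ : Formula langHAP 2) : {n : ℕ} → Formula langHAPf n → Prop
  | basic {n : ℕ} {φ : Formula langHAP n} : HAP.Basic φ → HAPfAx ψ (toF φ)
  | ind {n : ℕ} (χ : Formula langHAPf (n + 1)) :
      HAPfAx ψ (inductionAxiom (L := langHAPf) (Sum.inl HAPFunc.zero) (Sum.inl HAPFunc.succ) χ)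
  /-- `∃ y, ψ(x, y) → f(x) ↓` -/
  | f_den {n : ℕ} (x : Fin n) :
      HAPfAx ψ (Formula.ex ((toF ψ).subst ![vr x.succ, vr 0]) →ₚ (fTm (vr x)) ↓ₚ)
  /-- `f(x) ↓ → ψ(x, f(x))` -/
  | f_spec {n : ℕ} (x : Fin n) :
      HAPfAx ψ ((fTm (vr x)) ↓ₚ →ₚ (toF ψ).subst ![vr x, fTm (vr x)])

/-- The system HAP extended with `f`. -/
def HAPf (ψ : Formula langHAP 2) : Axioms langHAPf := fun _ => {φ | HAPfAx ψ φ}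

/-! The symbol `f` is added by forcing. A condition is an operation `p` that codes a partial choice
function for ψ: it is total, and for each `x` either `p x = 0` (no information) or `p x = S y` with
ψ(x, y). Which case holds at `x` is settled by the condition itself, so no excluded middle is
needed. Conditions only ever give correct values, which yields the axiom `f(x) ↓ → ψ(x, f(x))`. If
ψ(x, y) holds and `p` gives nothing at `x`, then `p` can be changed at `x` alone to the value `S y`
(`exists_updates`, `exists_refines_of_isZero`). So conditions with a value at `x` are dense, which
yields `∃ y, ψ(x, y) → f(x) ↓`.

Two further facts finish the argument. For each formula of the larger language, "`p` forces χ" is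
expressed by a formula of HAP (`definablyForced_sem`), so induction for forced statements follows
from induction in HAP (`forcingModel_inductive`). A formula without `f` is forced exactly as far as
it is true (`forcingModel_sem`), and conditions exist (`iSup_cond`), so a forced formula without `f`
is true.

The argument is carried out semantically, with truth values in frames. `termModel` is a model of HAP
whose elements are variables and in which only provable formulas have value `⊤` (`termModel_sem`,
`prf_of_truth_eq_top`). Over any model `M` of HAP, `forcingModel` has the same elements as `M`, its
truth values are closed sets of conditions, and it satisfies all axioms of the extension
(`forcingModel_isModel`). If the extension proves φ, `soundness` makes φ true in the forcing model
over the term model, hence true in the term model, hence provable in HAP. The converse is an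
induction on derivations. -/

namespace LPT

universe u v u' v'

variable {L : FirstOrder.Language.{u, v}} {L' : FirstOrder.Language.{u', v'}}

/-! ### Substitution -/

theorem Tm.subst_subst {n m k : ℕ} (t : Tm L n) (σ : Fin n → Tm L m) (τ : Fin m → Tm L k) :
    (t.subst σ).subst τ = t.subst (fun i => (σ i).subst τ) := by
  induction t with
  | var i => rfl
  | func F ts ih => simp [FirstOrder.Language.Term.subst, ih]

theorem Tm.subst_vr {n : ℕ} (t : Tm L n) : t.subst vr = t := by
  induction t with
  | var i => rfl
  | func F ts ih => simp [FirstOrder.Language.Term.subst, ih]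

theorem Tm.relabel_eq_subst {n m : ℕ} (t : Tm L n) (ρ : Fin n → Fin m) :
    t.relabel ρ = t.subst (fun i => vr (ρ i)) := by
  induction t with
  | var i => rfl
  | func F ts ih => simp [FirstOrder.Language.Term.subst, FirstOrder.Language.Term.relabel, ih]

theorem liftSubst_zero {n m : ℕ} (σ : Fin n → Tm L m) : liftSubst σ 0 = vr 0 := rfl

theorem liftSubst_succ {n m : ℕ} (σ : Fin n → Tm L m) (i : Fin n) :
    liftSubst σ i.succ = (σ i).subst (fun i => vr i.succ) := by
  simp [liftSubst, Tm.relabel_eq_subst]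

theorem liftSubst_subst {n m k : ℕ} (σ : Fin n → Tm L m) (τ : Fin m → Tm L k) :
    (fun i => (liftSubst σ i).subst (liftSubst τ)) = liftSubst (fun i => (σ i).subst τ) := by
  funext i
  refine Fin.cases rfl (fun i => ?_) i
  simp only [liftSubst_succ, Tm.subst_subst]
  congr 1
  funext j
  simp [FirstOrder.Language.Term.subst, liftSubst_succ]

theorem liftSubst_vr {n m : ℕ} (ρ : Fin n → Fin m) :
    liftSubst (L := L) (fun i => vr (ρ i)) =
      fun i => vr ((Fin.cons 0 (fun j => (ρ j).succ) : Fin (n + 1) → Fin (m + 1)) i) := by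
  funext i
  refine Fin.cases rfl (fun i => ?_) i
  simp [liftSubst_succ, FirstOrder.Language.Term.subst]

theorem liftSubst_vr_id {n : ℕ} : liftSubst (L := L) (vr (n := n)) = vr := by
  funext i
  refine Fin.cases rfl (fun i => ?_) i
  simp [liftSubst_succ, FirstOrder.Language.Term.subst]

namespace Formula

theorem subst_subst {n m k : ℕ} (φ : Formula L n) (σ : Fin n → Tm L m) (τ : Fin m → Tm L k) :
    (φ.subst σ).subst τ = φ.subst (fun i => (σ i).subst τ) := by
  induction φ generalizing m k with
  | bot => rfl
  | equal t₁ t₂ => simp [subst, Tm.subst_subst]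
  | rel R ts => simp [subst, Tm.subst_subst]
  | and φ ψ ih₁ ih₂ => simp [subst, ih₁, ih₂]
  | or φ ψ ih₁ ih₂ => simp [subst, ih₁, ih₂]
  | imp φ ψ ih₁ ih₂ => simp [subst, ih₁, ih₂]
  | all φ ih => simp [subst, ih, liftSubst_subst]
  | ex φ ih => simp [subst, ih, liftSubst_subst]

theorem subst_vr {n : ℕ} (φ : Formula L n) : φ.subst vr = φ := by
  induction φ with
  | bot => rfl
  | equal t₁ t₂ => simp [subst, Tm.subst_vr]
  | rel R ts => simp [subst, Tm.subst_vr]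
  | and φ ψ ih₁ ih₂ => simp [subst, ih₁, ih₂]
  | or φ ψ ih₁ ih₂ => simp [subst, ih₁, ih₂]
  | imp φ ψ ih₁ ih₂ => simp [subst, ih₁, ih₂]
  | all φ ih => simp [subst, ih, liftSubst_vr_id]
  | ex φ ih => simp [subst, ih, liftSubst_vr_id]

theorem shift_subst {n m : ℕ} (φ : Formula L n) (σ : Fin n → Tm L m) :
    φ.shift.subst (liftSubst σ) = (φ.subst σ).shift := by
  simp [shift, subst_subst, FirstOrder.Language.Term.subst, liftSubst_succ]

theorem subst_lift_inst {n m : ℕ} (φ : Formula L (n + 1)) (σ : Fin n → Tm L m) (t : Tm L m) :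
    (φ.subst (liftSubst σ)).inst t = φ.subst (Fin.cons t σ) := by
  rw [inst, subst_subst]
  congr 1
  funext i
  refine Fin.cases rfl (fun i => ?_) i
  simp [liftSubst_succ, Tm.subst_subst, FirstOrder.Language.Term.subst, Tm.subst_vr]

theorem inst_subst {n m : ℕ} (φ : Formula L (n + 1)) (σ : Fin n → Tm L m) (t : Tm L n) :
    (φ.inst t).subst σ = (φ.subst (liftSubst σ)).inst (t.subst σ) := by
  rw [subst_lift_inst, inst, subst_subst]
  congr 1
  funext i
  refine Fin.cases rfl (fun i => ?_) i
  simp [FirstOrder.Language.Term.subst]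

theorem conj_subst {n m k : ℕ} (φ : Fin k → Formula L n) (σ : Fin n → Tm L m) :
    (conj φ).subst σ = conj (fun i => (φ i).subst σ) := by
  induction k with
  | zero => rfl
  | succ k ih => simp [conj, subst, ih]

theorem den_subst {n m : ℕ} (t : Tm L n) (σ : Fin n → Tm L m) :
    (t ↓ₚ).subst σ = (t.subst σ) ↓ₚ := rfl

theorem inductionAxiom_subst (zero : L.Functions 0) (succ : L.Functions 1) {n m : ℕ}
    (χ : Formula L (n + 1)) (σ : Fin n → Tm L m) :
    (inductionAxiom zero succ χ).subst σ = inductionAxiom zero succ (χ.subst (liftSubst σ)) := by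
  simp only [inductionAxiom, subst, inst_subst, subst_subst]
  congr 4
  · simp [FirstOrder.Language.Constants.term, FirstOrder.Language.Term.subst]
    exact Subsingleton.elim _ _
  · congr 1
    funext i
    refine Fin.cases ?_ (fun i => ?_) i
    · simp [FirstOrder.Language.Functions.apply₁, FirstOrder.Language.Term.subst, liftSubst_zero]
      exact funext fun j => by rw [Subsingleton.elim j 0]; rfl
    · simp [FirstOrder.Language.Term.subst, liftSubst_succ, Tm.subst_subst]

end Formula

theorem onTerm_subst (ι : L →ᴸ L') {n m : ℕ} (t : Tm L n) (σ : Fin n → Tm L m) :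
    ι.onTerm (t.subst σ) = (ι.onTerm t).subst (fun i => ι.onTerm (σ i)) := by
  induction t with
  | var i => rfl
  | func F ts ih => simp [FirstOrder.Language.Term.subst, FirstOrder.Language.LHom.onTerm, ih]

theorem onTerm_liftSubst (ι : L →ᴸ L') {n m : ℕ} (σ : Fin n → Tm L m) :
    (fun i => ι.onTerm (liftSubst σ i)) = liftSubst (fun i => ι.onTerm (σ i)) := by
  funext i
  refine Fin.cases rfl (fun i => ?_) i
  simp [liftSubst_succ, onTerm_subst, FirstOrder.Language.LHom.onTerm]

namespace Formula

theorem mapLang_subst (ι : L →ᴸ L') {n m : ℕ} (φ : Formula L n) (σ : Fin n → Tm L m) :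
    (φ.subst σ).mapLang ι = (φ.mapLang ι).subst (fun i => ι.onTerm (σ i)) := by
  induction φ generalizing m with
  | bot => rfl
  | equal t₁ t₂ => simp [subst, mapLang, onTerm_subst]
  | rel R ts => simp [subst, mapLang, onTerm_subst]
  | and φ ψ ih₁ ih₂ => simp [subst, mapLang, ih₁, ih₂]
  | or φ ψ ih₁ ih₂ => simp [subst, mapLang, ih₁, ih₂]
  | imp φ ψ ih₁ ih₂ => simp [subst, mapLang, ih₁, ih₂]
  | all φ ih => simp [subst, mapLang, ih, onTerm_liftSubst]
  | ex φ ih => simp [subst, mapLang, ih, onTerm_liftSubst]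

theorem mapLang_shift (ι : L →ᴸ L') {n : ℕ} (φ : Formula L n) :
    φ.shift.mapLang ι = (φ.mapLang ι).shift := by
  simp [shift, mapLang_subst, FirstOrder.Language.LHom.onTerm]

theorem mapLang_inst (ι : L →ᴸ L') {n : ℕ} (φ : Formula L (n + 1)) (t : Tm L n) :
    (φ.inst t).mapLang ι = (φ.mapLang ι).inst (ι.onTerm t) := by
  rw [inst, mapLang_subst, inst]
  congr 1
  funext i
  refine Fin.cases rfl (fun i => rfl) i

theorem mapLang_conj (ι : L →ᴸ L') {n k : ℕ} (φ : Fin k → Formula L n) :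
    (conj φ).mapLang ι = conj (fun i => (φ i).mapLang ι) := by
  induction k with
  | zero => rfl
  | succ k ih => simp [conj, mapLang, ih]

theorem mapLang_inductionAxiom (ι : L →ᴸ L') (zero : L.Functions 0) (succ : L.Functions 1) {n : ℕ}
    (χ : Formula L (n + 1)) :
    (inductionAxiom zero succ χ).mapLang ι =
      inductionAxiom (ι.onFunction zero) (ι.onFunction succ) (χ.mapLang ι) := by
  simp only [inductionAxiom, mapLang, mapLang_inst, mapLang_subst]
  congr 4
  · simp [FirstOrder.Language.Constants.term, FirstOrder.Language.LHom.onTerm]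
    exact Subsingleton.elim _ _
  · congr 1
    funext i
    refine Fin.cases ?_ (fun i => rfl) i
    simp [FirstOrder.Language.Functions.apply₁, FirstOrder.Language.LHom.onTerm]
    exact funext fun j => by rw [Subsingleton.elim j 0]; rfl

end Formula

/-! ### Admissible rules -/

/-- A set of axioms closed under renaming of variables. -/
def Renamable (T : Axioms L) : Prop :=
  ∀ {n m : ℕ} (φ : Formula L n) (ρ : Fin n → Fin m), φ ∈ T n → φ.subst (fun i => vr (ρ i)) ∈ T m

variable {T : Axioms L}

namespace Prf

open Formula

theorem rename (hT : Renamable T) {n m : ℕ} {φ : Formula L n} (h : Prf T φ) (ρ : Fin n → Fin m) :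
    Prf T (φ.subst (fun i => vr (ρ i))) := by
  induction h generalizing m with
  | ax h => exact .ax (hT _ ρ h)
  | id φ => exact .id _
  | mp _ _ ih₁ ih₂ => exact .mp (ih₁ ρ) (ih₂ ρ)
  | trans _ _ ih₁ ih₂ => exact .trans (ih₁ ρ) (ih₂ ρ)
  | and_left φ ψ => exact .and_left _ _
  | and_right φ ψ => exact .and_right _ _
  | and_intro _ _ ih₁ ih₂ => exact .and_intro (ih₁ ρ) (ih₂ ρ)
  | or_left φ ψ => exact .or_left _ _
  | or_right φ ψ => exact .or_right _ _
  | or_elim _ _ ih₁ ih₂ => exact .or_elim (ih₁ ρ) (ih₂ ρ)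
  | curry _ ih => exact .curry (ih ρ)
  | uncurry _ ih => exact .uncurry (ih ρ)
  | bot_elim φ => exact .bot_elim _
  | all_intro _ ih =>
    refine .all_intro ?_
    rw [← shift_subst, liftSubst_vr]
    exact ih _
  | all_elim φ t =>
    simp only [subst, inst_subst, den_subst]
    exact .all_elim _ _
  | ex_intro φ t =>
    simp only [subst, inst_subst, den_subst]
    exact .ex_intro _ _
  | ex_elim _ ih =>
    refine .ex_elim ?_
    rw [← shift_subst, liftSubst_vr]
    exact ih _
  | eq_refl x => exact .eq_refl _
  | eq_symm x y => exact .eq_symm _ _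
  | eq_trans x y z => exact .eq_trans _ _ _
  | eq_func F x y =>
    simp only [subst, conj_subst, den_subst]
    exact .eq_func _ _ _
  | eq_rel R x y =>
    simp only [subst, conj_subst]
    exact .eq_rel _ _ _
  | const_den c ts => exact .const_den _ _
  | func_strict F ts i => exact .func_strict _ _ _
  | rel_strict R ts i => exact .rel_strict _ _ _
  | eq_strict s t => exact .eq_strict _ _

theorem weaken {n : ℕ} {φ ψ : Formula L n} (h : Prf T ψ) : Prf T (φ →ₚ ψ) :=
  .mp h (.curry (.and_left _ _))

theorem imp_mp {n : ℕ} {Γ φ ψ : Formula L n} (h₁ : Prf T (Γ →ₚ φ →ₚ ψ)) (h₂ : Prf T (Γ →ₚ φ)) :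
    Prf T (Γ →ₚ ψ) :=
  .trans (.and_intro (.id _) h₂) (.uncurry h₁)

theorem gen {n : ℕ} {φ : Formula L (n + 1)} (h : Prf T φ) : Prf T (all φ) :=
  .mp (.id (bot →ₚ bot)) (.all_intro (.weaken h))

theorem conj_intro {n k : ℕ} {Γ : Formula L n} {φ : Fin k → Formula L n}
    (h : ∀ i, Prf T (Γ →ₚ φ i)) : Prf T (Γ →ₚ conj φ) := by
  induction k with
  | zero => exact .weaken (.id _)
  | succ k ih => exact .and_intro (h 0) (ih fun i => h i.succ)

/-- A derivable formula may be instantiated at terms that denote. -/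
theorem subst_den (hT : Renamable T) {n m : ℕ} {φ : Formula L n} (h : Prf T φ) {Γ : Formula L m}
    (σ : Fin n → Tm L m) (hσ : ∀ i, Prf T (Γ →ₚ (σ i) ↓ₚ)) : Prf T (Γ →ₚ φ.subst σ) := by
  induction n with
  | zero =>
    -- With no variables to replace, `σ` is vacuously a renaming.
    rw [Subsingleton.elim σ (fun i => vr (i.elim0 : Fin m))]
    exact .weaken (h.rename hT _)
  | succ n ih =>
    -- Variable 0 is generalized, the induction hypothesis treats the others, and the quantifier is
    -- then instantiated at the denoting term `σ 0`.
    have h₁ := ih h.gen (fun i => σ i.succ) (fun i => hσ i.succ)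
    have h₂ := Prf.trans (.and_intro h₁ (hσ 0)) (.all_elim _ _)
    rwa [subst_lift_inst, show (Fin.cons (σ 0) fun i => σ i.succ) = σ from Fin.cons_self_tail σ]
      at h₂

theorem eq_den_left {n : ℕ} (s t : Tm L n) : Prf T (s =ₚ t →ₚ s ↓ₚ) :=
  .trans (.eq_strict s t) (.and_left _ _)

theorem eq_den_right {n : ℕ} (s t : Tm L n) : Prf T (s =ₚ t →ₚ t ↓ₚ) :=
  .trans (.eq_strict s t) (.and_right _ _)

theorem tm_symm (hT : Renamable T) {n : ℕ} {Γ : Formula L n} {s t : Tm L n}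
    (h : Prf T (Γ →ₚ s =ₚ t)) : Prf T (Γ →ₚ t =ₚ s) := by
  refine imp_mp (subst_den hT (.eq_symm (0 : Fin 2) 1) ![s, t] fun i => ?_) h
  fin_cases i
  · exact h.trans (eq_den_left _ _)
  · exact h.trans (eq_den_right _ _)

theorem tm_trans (hT : Renamable T) {n : ℕ} {Γ : Formula L n} {s t r : Tm L n}
    (h : Prf T (Γ →ₚ s =ₚ t)) (h' : Prf T (Γ →ₚ t =ₚ r)) : Prf T (Γ →ₚ s =ₚ r) := by
  refine imp_mp (subst_den hT (.eq_trans (0 : Fin 3) 1 2) ![s, t, r] fun i => ?_)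
    (.and_intro h h')
  fin_cases i
  · exact h.trans (eq_den_left _ _)
  · exact h.trans (eq_den_right _ _)
  · exact h'.trans (eq_den_right _ _)

theorem tm_func (hT : Renamable T) {n k : ℕ} {Γ : Formula L n} (F : L.Functions k)
    {ss ts : Fin k → Tm L n} (h : ∀ i, Prf T (Γ →ₚ ss i =ₚ ts i))
    (h' : Prf T (Γ →ₚ (FirstOrder.Language.Term.func F ss) ↓ₚ)) :
    Prf T (Γ →ₚ FirstOrder.Language.Term.func F ss =ₚ FirstOrder.Language.Term.func F ts) := by
  -- The congruence axiom speaks of variables only, so it is taken for `2 * k` distinct variables,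
  -- the first half replaced by `ss` and the second by `ts`.
  have key := subst_den (Γ := Γ) hT (.eq_func F (Fin.castAdd k) (Fin.natAdd k)) (Fin.append ss ts)
    fun i => by
      refine Fin.addCases (fun i => ?_) (fun i => ?_) i
      · rw [Fin.append_left]; exact (h i).trans (eq_den_left _ _)
      · rw [Fin.append_right]; exact (h i).trans (eq_den_right _ _)
  simp only [subst, conj_subst, den_subst, FirstOrder.Language.Term.subst, Fin.append_left,
    Fin.append_right] at key
  exact imp_mp key (.and_intro (conj_intro h) h')

end Prf

end LPT

/-! ### Frames -/

section Frame

variable {H : Type*} [Order.Frame H]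

/-- In this and the following congruences, `u ⊓ a = u ⊓ a'` says that `a` and `a'` agree at stage
`u`. They drive the inductions behind `val_subst` and `sem_subst`. -/
theorem inf_congr_inf {u a b a' b' : H} (h : u ⊓ a = u ⊓ a') (h' : u ⊓ b = u ⊓ b') :
    u ⊓ (a ⊓ b) = u ⊓ (a' ⊓ b') := by
  rw [inf_inf_distrib_left, h, h', ← inf_inf_distrib_left]

theorem inf_congr_sup {u a b a' b' : H} (h : u ⊓ a = u ⊓ a') (h' : u ⊓ b = u ⊓ b') :
    u ⊓ (a ⊔ b) = u ⊓ (a' ⊔ b') := by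
  rw [inf_sup_left, h, h', ← inf_sup_left]

theorem inf_congr_iSup {ι : Sort*} {u : H} {a b : ι → H} (h : ∀ i, u ⊓ a i = u ⊓ b i) :
    u ⊓ ⨆ i, a i = u ⊓ ⨆ i, b i := by
  simp only [inf_iSup_eq, h]

theorem inf_congr_iInf {ι : Sort*} {u : H} {a b : ι → H} (h : ∀ i, u ⊓ a i = u ⊓ b i) :
    u ⊓ ⨅ i, a i = u ⊓ ⨅ i, b i := by
  refine le_antisymm ?_ ?_
  · exact le_inf inf_le_left (le_iInf fun i =>
      (inf_le_inf_left u (iInf_le a i)).trans ((h i).trans_le inf_le_right))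
  · exact le_inf inf_le_left (le_iInf fun i =>
      (inf_le_inf_left u (iInf_le b i)).trans ((h i).symm.trans_le inf_le_right))

theorem inf_congr_himp {u a b a' b' : H} (h : u ⊓ a = u ⊓ a') (h' : u ⊓ b = u ⊓ b') :
    u ⊓ (a ⇨ b) = u ⊓ (a' ⇨ b') := by
  have aux : ∀ {a b a' b' : H}, u ⊓ a = u ⊓ a' → u ⊓ b = u ⊓ b' → u ⊓ (a ⇨ b) ≤ a' ⇨ b' := by
    intro a b a' b' h h'
    rw [le_himp_iff]
    calc u ⊓ (a ⇨ b) ⊓ a' = u ⊓ a ⊓ (a ⇨ b) := by rw [h]; ac_rfl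
      _ = u ⊓ b ⊓ (a ⇨ b) ⊓ a := by rw [inf_assoc, inf_himp]; simp [inf_comm, inf_left_comm]
      _ ≤ u ⊓ b' := by rw [h']; exact inf_le_left.trans inf_le_left
      _ ≤ b' := inf_le_right
  exact le_antisymm (le_inf inf_le_left (aux h h')) (le_inf inf_le_left (aux h.symm h'.symm))

/-- To prove a consequence of an existential statement one may fix a witness. -/
theorem le_of_le_iSup {ι : Sort*} {u g : H} {a : ι → H} (h : u ≤ ⨆ i, a i)
    (h' : ∀ i, u ⊓ a i ≤ g) : u ≤ g :=
  (le_inf le_rfl h).trans ((inf_iSup_eq u a).trans_le (iSup_le h'))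

/-- Reasoning by stages in the style of Kripke–Joyal: `u` is what is currently assumed, and choosing
a witness costs passing to a smaller `u'`. Nearly every argument inside a model below uses this rule
or `sup_elim`. -/
theorem iSup_elim {ι : Sort*} {u g : H} {a : ι → H} (h : u ≤ ⨆ i, a i)
    (h' : ∀ i, ∀ u' ≤ u, u' ≤ a i → u' ≤ g) : u ≤ g :=
  le_of_le_iSup h fun i => h' i _ inf_le_left inf_le_right

theorem sup_elim {u g a b : H} (h : u ≤ a ⊔ b) (h₁ : ∀ u' ≤ u, u' ≤ a → u' ≤ g)
    (h₂ : ∀ u' ≤ u, u' ≤ b → u' ≤ g) : u ≤ g :=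
  (le_inf le_rfl h).trans ((inf_sup_left u a b).trans_le
    (sup_le (h₁ _ inf_le_left inf_le_right) (h₂ _ inf_le_left inf_le_right)))

/-- Finitely many witnesses can be chosen simultaneously, because binary meets distribute over
arbitrary joins. It supplies values for all arguments of a function symbol at once. -/
theorem le_iSup_iInf_fin {D : Type*} {k : ℕ} {u : H} {a : Fin k → D → H}
    (h : ∀ i, u ≤ ⨆ x, a i x) : u ≤ ⨆ w : Fin k → D, ⨅ i, a i (w i) := by
  induction k with
  | zero => exact le_iSup_of_le ![] (by simp)
  | succ k ih =>
    refine le_of_le_iSup (h 0) fun x => ?_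
    refine le_of_le_iSup (inf_le_left.trans (ih fun i => h i.succ)) fun w => ?_
    refine le_iSup_of_le (Matrix.vecCons x w) (le_iInf fun i => Fin.cases ?_ (fun i => ?_) i)
    · exact inf_le_left.trans inf_le_right
    · exact inf_le_right.trans (iInf_le _ i)

end Frame

/-! ### Frame-valued models and soundness. -/

namespace LPT

universe u v w x

open FirstOrder.Language (Term)

/-- A model of the logic of partial terms with truth values in a frame. Function symbols are
interpreted by single-valued relations. -/
structure FrameModel (L : FirstOrder.Language.{u, v}) (H : Type w) [Order.Frame H]
    (D : Type x) where
  eq : D → D → H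
  eq_refl (x : D) : eq x x = ⊤
  eq_symm (x y : D) : eq x y ≤ eq y x
  eq_trans (x y z : D) : eq x y ⊓ eq y z ≤ eq x z
  fn {k : ℕ} (F : L.Functions k) : (Fin k → D) → D → H
  fn_congr {k : ℕ} (F : L.Functions k) (x y : Fin k → D) (z w : D) :
    (⨅ i, eq (x i) (y i)) ⊓ eq z w ⊓ fn F x z ≤ fn F y w
  fn_unique {k : ℕ} (F : L.Functions k) (x : Fin k → D) (z w : D) : fn F x z ⊓ fn F x w ≤ eq z w
  const_total (c : L.Functions 0) (x : Fin 0 → D) : ⨆ z, fn c x z = ⊤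

namespace FrameModel

variable {L : FirstOrder.Language.{u, v}} {H : Type w} [Order.Frame H] {D : Type x}
  (M : FrameModel L H D)

/-- The truth value of `t = z`. -/
def val {n : ℕ} : Tm L n → (Fin n → D) → D → H
  | Term.var i, v, z => M.eq (v i) z
  | Term.func F ts, v, z => ⨆ w : Fin _ → D, (⨅ i, val (ts i) v (w i)) ⊓ M.fn F w z

/-- The truth value of a formula (in a language without relation symbols). -/
def sem [L.IsAlgebraic] : {n : ℕ} → Formula L n → (Fin n → D) → H
  | _, .bot, _ => ⊥
  | _, .equal s t, v => ⨆ z, M.val s v z ⊓ M.val t v z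
  | _, .rel R _, _ => isEmptyElim R
  | _, .and φ ψ, v => sem φ v ⊓ sem ψ v
  | _, .or φ ψ, v => sem φ v ⊔ sem ψ v
  | _, .imp φ ψ, v => sem φ v ⇨ sem ψ v
  | _, .all φ, v => ⨅ x, sem φ (Matrix.vecCons x v)
  | _, .ex φ, v => ⨆ x, sem φ (Matrix.vecCons x v)

variable {M}

section Sem

variable [L.IsAlgebraic] {n : ℕ} (v : Fin n → D)

theorem sem_bot : M.sem (.bot : Formula L n) v = ⊥ := rfl

theorem sem_equal (s t : Tm L n) : M.sem (s =ₚ t) v = ⨆ z, M.val s v z ⊓ M.val t v z := rfl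

theorem sem_and (φ ψ : Formula L n) : M.sem (φ ∧ₚ ψ) v = M.sem φ v ⊓ M.sem ψ v := rfl

theorem sem_or (φ ψ : Formula L n) : M.sem (φ ∨ₚ ψ) v = M.sem φ v ⊔ M.sem ψ v := rfl

theorem sem_imp (φ ψ : Formula L n) : M.sem (φ →ₚ ψ) v = M.sem φ v ⇨ M.sem ψ v := rfl

end Sem

theorem val_congr {n : ℕ} (t : Tm L n) (v : Fin n → D) (z w : D) :
    M.eq z w ⊓ M.val t v z ≤ M.val t v w := by
  cases t with
  | var i => rw [val, inf_comm]; exact M.eq_trans _ _ _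
  | func F ts =>
    simp only [val, inf_iSup_eq]
    refine iSup_mono fun x => ?_
    refine le_inf (inf_le_right.trans inf_le_left) (le_trans ?_ (M.fn_congr F x x z w))
    simp only [M.eq_refl, iInf_top, top_inf_eq]
    exact inf_le_inf_left _ inf_le_right

theorem val_unique {n : ℕ} (t : Tm L n) (v : Fin n → D) (z w : D) :
    M.val t v z ⊓ M.val t v w ≤ M.eq z w := by
  induction t generalizing z w with
  | var i => exact (inf_le_inf_right _ (M.eq_symm _ _)).trans (M.eq_trans _ _ _)
  | func F ts ih =>
    simp only [val, inf_iSup_eq, iSup_inf_eq]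
    refine iSup_le fun y => iSup_le fun x => ?_
    refine le_trans (le_inf ?_ (inf_le_right.trans inf_le_right)) (M.fn_unique F y z w)
    refine le_trans ?_ (M.fn_congr F x y z z)
    rw [M.eq_refl, inf_top_eq]
    refine le_inf (le_iInf fun i => le_trans ?_ (ih i (x i) (y i)))
      (inf_le_left.trans inf_le_right)
    exact le_inf (inf_le_left.trans (inf_le_left.trans (iInf_le _ i)))
      (inf_le_right.trans (inf_le_left.trans (iInf_le _ i)))

theorem sem_den [L.IsAlgebraic] {n : ℕ} (t : Tm L n) (v : Fin n → D) :
    M.sem (t ↓ₚ) v = ⨆ z, M.val t v z := by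
  simp [den, sem]

theorem val_subst {n m : ℕ} {u : H} {σ : Fin n → Tm L m} {v : Fin m → D} {w : Fin n → D}
    (h : ∀ i, u ≤ M.val (σ i) v (w i)) (t : Tm L n) (z : D) :
    u ⊓ M.val (t.subst σ) v z = u ⊓ M.val t w z := by
  induction t generalizing z with
  | var i =>
    refine le_antisymm (le_inf inf_le_left ?_) (le_inf inf_le_left ?_)
    · exact (inf_le_inf_right _ (h i)).trans (val_unique _ _ _ _)
    · rw [inf_comm]; exact (inf_le_inf_left _ (h i)).trans (val_congr _ _ _ _)
  | func F ts ih =>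
    exact inf_congr_iSup fun x => inf_congr_inf (inf_congr_iInf fun i => ih i _) rfl

theorem val_rename {n m : ℕ} (ρ : Fin n → Fin m) (t : Tm L n) (v : Fin m → D) :
    M.val (t.subst fun i => vr (ρ i)) v = M.val t (fun i => v (ρ i)) := by
  funext z
  have h := val_subst (M := M) (u := ⊤) (σ := fun i => vr (ρ i)) (v := v) (w := fun i => v (ρ i))
    (fun i => (M.eq_refl _).ge) t z
  simpa using h

theorem le_val_liftSubst {n m : ℕ} {u : H} {σ : Fin n → Tm L m} {v : Fin m → D} {w : Fin n → D}
    (h : ∀ i, u ≤ M.val (σ i) v (w i)) (x : D) (i : Fin (n + 1)) :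
    u ≤ M.val (liftSubst σ i) (Matrix.vecCons x v) (Matrix.vecCons x w i) := by
  refine Fin.cases ?_ (fun i => ?_) i
  · exact le_top.trans (M.eq_refl x).ge
  · rw [liftSubst_succ, val_rename]
    exact h i

/-- Terms need not denote, so the two values agree only at a stage `u` where each `σ i` has the
value `w i`. Under a quantifier the new variable has its own value at every stage, so the same `u`
serves throughout the induction. -/
theorem sem_subst [L.IsAlgebraic] {n m : ℕ} {u : H} {σ : Fin n → Tm L m} {v : Fin m → D}
    {w : Fin n → D} (h : ∀ i, u ≤ M.val (σ i) v (w i)) (φ : Formula L n) :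
    u ⊓ M.sem (φ.subst σ) v = u ⊓ M.sem φ w := by
  induction φ generalizing m with
  | bot => rfl
  | equal t₁ t₂ =>
    exact inf_congr_iSup fun x => inf_congr_inf (val_subst h t₁ x) (val_subst h t₂ x)
  | rel R ts => exact isEmptyElim R
  | and φ ψ ih₁ ih₂ => exact inf_congr_inf (ih₁ h) (ih₂ h)
  | or φ ψ ih₁ ih₂ => exact inf_congr_sup (ih₁ h) (ih₂ h)
  | imp φ ψ ih₁ ih₂ => exact inf_congr_himp (ih₁ h) (ih₂ h)
  | all φ ih => exact inf_congr_iInf fun x => ih (le_val_liftSubst h x)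
  | ex φ ih => exact inf_congr_iSup fun x => ih (le_val_liftSubst h x)

theorem sem_rename [L.IsAlgebraic] {n m : ℕ} (ρ : Fin n → Fin m) (φ : Formula L n)
    (v : Fin m → D) :
    M.sem (φ.subst fun i => vr (ρ i)) v = M.sem φ (fun i => v (ρ i)) := by
  have h := sem_subst (M := M) (u := ⊤) (σ := fun i => vr (ρ i)) (v := v) (w := fun i => v (ρ i))
    (fun i => (M.eq_refl _).ge) φ
  simpa using h

theorem sem_shift [L.IsAlgebraic] {n : ℕ} (φ : Formula L n) (x : D) (v : Fin n → D) :
    M.sem φ.shift (Matrix.vecCons x v) = M.sem φ v := by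
  rw [Formula.shift, sem_rename]
  rfl

theorem sem_inst [L.IsAlgebraic] {n : ℕ} (φ : Formula L (n + 1)) (t : Tm L n) (x : D)
    (v : Fin n → D) :
    M.val t v x ⊓ M.sem (φ.inst t) v = M.val t v x ⊓ M.sem φ (Matrix.vecCons x v) :=
  sem_subst (fun i => Fin.cases le_rfl (fun _ => le_top.trans (M.eq_refl _).ge) i) φ

theorem sem_conj [L.IsAlgebraic] {n k : ℕ} (φ : Fin k → Formula L n) (v : Fin n → D) :
    M.sem (Formula.conj φ) v = ⨅ i, M.sem (φ i) v := by
  induction k with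
  | zero => simp [Formula.conj, sem, iInf_of_empty]
  | succ k ih =>
    rw [Formula.conj, sem, ih]
    refine le_antisymm (le_iInf fun i => ?_) (le_inf (iInf_le _ 0) (le_iInf fun i => iInf_le _ _))
    exact Fin.cases inf_le_left (fun i => inf_le_right.trans (iInf_le _ i)) i

theorem sem_var_eq [L.IsAlgebraic] {n : ℕ} (i j : Fin n) (v : Fin n → D) :
    M.sem (vr i =ₚ vr j) v = M.eq (v i) (v j) := by
  refine le_antisymm (iSup_le fun z => ?_) (le_iSup_of_le (v j) ?_)
  · exact (inf_le_inf_left _ (M.eq_symm _ _)).trans (M.eq_trans _ _ _)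
  · exact le_inf le_rfl (le_top.trans (M.eq_refl _).ge)

theorem val_func_vr {n k : ℕ} (F : L.Functions k) (x : Fin k → Fin n) (v : Fin n → D) (z : D) :
    M.val (Term.func F fun i => vr (x i)) v z = M.fn F (fun i => v (x i)) z := by
  refine le_antisymm (iSup_le fun w => ?_) (le_iSup_of_le (fun i => v (x i)) ?_)
  · refine le_trans (inf_le_inf_right _ ?_) (M.fn_congr F w _ z z)
    rw [M.eq_refl, inf_top_eq]
    exact iInf_mono fun i => M.eq_symm _ _
  · exact le_inf (le_iInf fun i => le_top.trans (M.eq_refl _).ge) le_rfl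

theorem sem_imp_eq_top [L.IsAlgebraic] {n : ℕ} {φ ψ : Formula L n} {v : Fin n → D} :
    M.sem (φ →ₚ ψ) v = ⊤ ↔ M.sem φ v ≤ M.sem ψ v := himp_eq_top_iff

theorem soundness [L.IsAlgebraic] {T : Axioms L} (hM : ∀ n, ∀ φ ∈ T n, ∀ v, M.sem φ v = ⊤)
    {n : ℕ} {φ : Formula L n} (h : Prf T φ) (v : Fin n → D) : M.sem φ v = ⊤ := by
  induction h with
  | ax h => exact hM _ _ h v
  | id φ => exact sem_imp_eq_top.2 le_rfl
  | mp _ _ ih₁ ih₂ => exact top_le_iff.1 ((ih₁ v).ge.trans (sem_imp_eq_top.1 (ih₂ v)))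
  | trans _ _ ih₁ ih₂ =>
    exact sem_imp_eq_top.2 ((sem_imp_eq_top.1 (ih₁ v)).trans (sem_imp_eq_top.1 (ih₂ v)))
  | and_left φ ψ => exact sem_imp_eq_top.2 inf_le_left
  | and_right φ ψ => exact sem_imp_eq_top.2 inf_le_right
  | and_intro _ _ ih₁ ih₂ =>
    exact sem_imp_eq_top.2 (le_inf (sem_imp_eq_top.1 (ih₁ v)) (sem_imp_eq_top.1 (ih₂ v)))
  | or_left φ ψ => exact sem_imp_eq_top.2 le_sup_left
  | or_right φ ψ => exact sem_imp_eq_top.2 le_sup_right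
  | or_elim _ _ ih₁ ih₂ =>
    exact sem_imp_eq_top.2 (sup_le (sem_imp_eq_top.1 (ih₁ v)) (sem_imp_eq_top.1 (ih₂ v)))
  | curry _ ih => exact sem_imp_eq_top.2 (le_himp_iff.2 (sem_imp_eq_top.1 (ih v)))
  | uncurry _ ih => exact sem_imp_eq_top.2 (le_himp_iff.1 (sem_imp_eq_top.1 (ih v)))
  | bot_elim φ => exact sem_imp_eq_top.2 bot_le
  | all_intro _ ih =>
    refine sem_imp_eq_top.2 (le_iInf fun x => ?_)
    simpa only [sem_shift] using sem_imp_eq_top.1 (ih (Matrix.vecCons x v))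
  | all_elim φ t =>
    refine sem_imp_eq_top.2 ?_
    rw [sem, sem_den, inf_iSup_eq]
    refine iSup_le fun x => ?_
    rw [inf_comm]
    refine le_trans (inf_le_inf_left _ (iInf_le _ x)) ?_
    rw [← sem_inst]
    exact inf_le_right
  | ex_intro φ t =>
    refine sem_imp_eq_top.2 ?_
    rw [sem, sem_den, inf_iSup_eq]
    refine iSup_le fun x => ?_
    rw [inf_comm, sem_inst]
    exact inf_le_right.trans (le_iSup (fun x => M.sem φ (Matrix.vecCons x v)) x)
  | ex_elim _ ih =>
    refine sem_imp_eq_top.2 (iSup_le fun x => ?_)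
    simpa only [sem_shift] using sem_imp_eq_top.1 (ih (Matrix.vecCons x v))
  | eq_refl x => rw [sem_var_eq, M.eq_refl]
  | eq_symm x y =>
    rw [sem_imp_eq_top, sem_var_eq, sem_var_eq]
    exact M.eq_symm _ _
  | eq_trans x y z =>
    rw [sem_imp_eq_top, sem_and, sem_var_eq, sem_var_eq, sem_var_eq]
    exact M.eq_trans _ _ _
  | eq_func F x y =>
    rw [sem_imp_eq_top, sem_and, sem_conj, sem_den, sem_equal]
    simp only [sem_var_eq, val_func_vr, inf_iSup_eq]
    refine iSup_mono fun z => le_inf inf_le_right ?_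
    refine le_trans ?_ (M.fn_congr F (fun i => v (x i)) _ z z)
    rw [M.eq_refl, inf_top_eq]
  | eq_rel R x y => exact isEmptyElim R
  | const_den c ts =>
    rw [sem_den, ← top_le_iff, ← M.const_total c isEmptyElim]
    exact iSup_mono fun z => le_iSup_of_le isEmptyElim (by simp)
  | func_strict F ts i =>
    rw [sem_imp_eq_top, sem_den, sem_den]
    refine iSup_le fun z => iSup_le fun w => le_iSup_of_le (w i) ?_
    exact inf_le_left.trans (iInf_le _ i)
  | rel_strict R ts i => exact isEmptyElim R
  | eq_strict s t =>
    rw [sem_imp_eq_top, sem_and, sem_den, sem_den]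
    exact le_inf (iSup_mono fun z => inf_le_left) (iSup_mono fun z => inf_le_right)

end FrameModel

end LPT

/-! ### Frames of closed lower sets -/

namespace Nucleus

variable {Q : Type*} [Preorder Q] {j : Nucleus (LowerSet Q)}

theorem mem_inf {A B : j.toSublocale} {q : Q} : q ∈ (A ⊓ B).1 ↔ q ∈ A.1 ∧ q ∈ B.1 := Iff.rfl

theorem mem_iInf {ι : Sort*} {A : ι → j.toSublocale} {q : Q} :
    q ∈ (⨅ i, A i).1 ↔ ∀ i, q ∈ (A i).1 := by
  rw [Sublocale.coe_iInf, LowerSet.mem_iInf_iff]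

theorem mem_himp {A B : j.toSublocale} {q : Q} :
    q ∈ (A ⇨ B).1 ↔ ∀ r ≤ q, r ∈ A.1 → r ∈ B.1 := by
  rw [Sublocale.coe_himp, ← LowerSet.Iic_le, le_himp_iff]
  exact ⟨fun h r hr hA => h ⟨hr, hA⟩, fun h r hr => h r hr.1 hr.2⟩

theorem closure_val (A : j.toSublocale) : j A.1 = A.1 := Nucleus.mem_range.1 A.2

/-- The closed lower set generated by a lower set. -/
def close (j : Nucleus (LowerSet Q)) (U : LowerSet Q) : j.toSublocale := ⟨j U, U, rfl⟩

theorem close_le {U : LowerSet Q} {A : j.toSublocale} : j.close U ≤ A ↔ U ≤ A.1 := by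
  refine ⟨fun h => j.le_apply.trans h, fun h => ?_⟩
  have := j.monotone h
  rwa [closure_val] at this

theorem close_inf (U V : LowerSet Q) : j.close (U ⊓ V) = j.close U ⊓ j.close V :=
  Subtype.ext j.map_inf

theorem iSup_eq_close {ι : Sort*} (A : ι → j.toSublocale) :
    ⨆ i, A i = j.close (⨆ i, (A i).1) := by
  refine le_antisymm (iSup_le fun i => (le_iSup (fun i => (A i).1) i).trans j.le_apply) ?_
  exact close_le.2 (iSup_le fun i => le_iSup A i)

theorem mem_iSup {ι : Sort*} {A : ι → j.toSublocale} {q : Q} :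
    q ∈ (⨆ i, A i).1 ↔ q ∈ j (⨆ i, (A i).1) := by
  rw [iSup_eq_close]; rfl

theorem mem_sup {A B : j.toSublocale} {q : Q} : q ∈ (A ⊔ B).1 ↔ q ∈ j (A.1 ⊔ B.1) := by
  suffices A ⊔ B = j.close (A.1 ⊔ B.1) by rw [this]; rfl
  refine le_antisymm (sup_le (show A.1 ≤ _ from le_sup_left.trans j.le_apply)
    (show B.1 ≤ _ from le_sup_right.trans j.le_apply)) ?_
  exact close_le.2 (sup_le (le_sup_left (a := A)) (le_sup_right (a := A)))

theorem mem_bot {q : Q} : q ∈ (⊥ : j.toSublocale).1 ↔ q ∈ j ⊥ := by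
  suffices (⊥ : j.toSublocale) = j.close ⊥ by rw [this]; rfl
  exact le_antisymm bot_le (close_le.2 bot_le)

/-- The nucleus of the canonical coverage of a preorder: a family covers `d` when every refinement
of `d` is a least upper bound of the members of the family below it. -/
def canonical (Q : Type*) [Preorder Q] : Nucleus (LowerSet Q) where
  toFun U := ⟨{a | ∀ d ≤ a, ∀ c, (∀ u ∈ U, u ≤ d → u ≤ c) → d ≤ c},
    fun _ _ hba ha d hd => ha d (hd.trans hba)⟩
  map_inf' U V := by
    refine le_antisymm (le_inf ?_ ?_) ?_
    · exact fun a ha d hd c hc => ha d hd c fun u hu => hc u hu.1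
    · exact fun a ha d hd c hc => ha d hd c fun u hu => hc u hu.2
    · exact fun a ha d hd c hc => ha.1 d hd c fun u hu hud =>
        ha.2 u (hud.trans hd) c fun v hv hvu => hc v ⟨U.lower hvu hu, hv⟩ (hvu.trans hud)
  idempotent' U a ha d hd c hc :=
    ha d hd c fun w hw hwd => hw w le_rfl c fun u hu huw => hc u hu (huw.trans hwd)
  le_apply' U a ha d hd c hc := hc d (U.lower hd ha) le_rfl

theorem mem_canonical {U : LowerSet Q} {a : Q} :
    a ∈ canonical Q U ↔ ∀ d ≤ a, ∀ c, (∀ u ∈ U, u ≤ d → u ≤ c) → d ≤ c := Iff.rfl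

/-- The canonical embedding of a preorder into the frame of closed lower sets. -/
def principal (a : Q) : (canonical Q).toSublocale :=
  -- Testing a covered element against the upper bound `a` itself shows that it lies below `a`.
  ⟨LowerSet.Iic a, LowerSet.Iic a, le_antisymm (fun _ hx => hx _ le_rfl a fun _ hu _ => hu)
    (Nucleus.le_apply)⟩

theorem mem_principal {a b : Q} : b ∈ (principal a).1 ↔ b ≤ a := Iff.rfl

theorem principal_le_principal {a b : Q} : principal a ≤ principal b ↔ a ≤ b :=
  LowerSet.Iic_le

theorem frame_ext {A B : j.toSublocale} (h : ∀ q, q ∈ A.1 ↔ q ∈ B.1) : A = B :=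
  Subtype.ext (SetLike.ext h)

/-- The second hypothesis says that the join is stable: every `d ≤ c` is the least upper bound of
the elements below both `d` and some `a i`. Stable joins are precisely what the canonical coverage
turns into joins of the frame; disjunctions and existential formulas are of this kind. -/
theorem principal_eq_iSup {ι : Sort*} {a : ι → Q} {c : Q} (h : ∀ i, a i ≤ c)
    (h' : ∀ d ≤ c, ∀ e, (∀ i, ∀ u ≤ a i, u ≤ d → u ≤ e) → d ≤ e) :
    principal c = ⨆ i, principal (a i) := by
  refine le_antisymm (fun x hx => ?_) (iSup_le fun i => principal_le_principal.2 (h i))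
  refine mem_iSup.2 (mem_canonical.2 fun d hd e he => h' d (hd.trans hx) e fun i u hu => he u ?_)
  exact LowerSet.mem_iSup_iff.2 ⟨i, hu⟩

theorem principal_eq_sup {a b c : Q} (ha : a ≤ c) (hb : b ≤ c)
    (h' : ∀ d ≤ c, ∀ e, (∀ u, u ≤ a ∨ u ≤ b → u ≤ d → u ≤ e) → d ≤ e) :
    principal c = principal a ⊔ principal b := by
  refine le_antisymm (fun x hx => ?_)
    (sup_le (principal_le_principal.2 ha) (principal_le_principal.2 hb))
  exact mem_sup.2 (mem_canonical.2 fun d hd e he => h' d (hd.trans hx) e fun u hu => he u hu)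

theorem principal_eq_bot {c : Q} (h : ∀ d, c ≤ d) : principal c = ⊥ := by
  refine le_antisymm (fun x hx => ?_) bot_le
  exact mem_bot.2 (mem_canonical.2 fun d hd e _ => (hd.trans hx).trans (h e))

end Nucleus

namespace LPT

universe u v

open FirstOrder.Language (Term)

open Filter

/-! ### The term model -/

/-- A formula whose free variables are named by natural numbers. -/
structure NamedFormula (L : FirstOrder.Language.{u, v}) (T : Axioms L) where
  {n : ℕ}
  form : Formula L n
  name : Fin n → ℕ

namespace NamedFormula

variable {L : FirstOrder.Language.{u, v}} {T : Axioms L}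

/-- The formula with its free variables placed among `N + 1` variables. -/
def atLevel (N : ℕ) (a : NamedFormula L T) : Formula L (N + 1) :=
  a.form.subst fun i => vr (Fin.ofNat (N + 1) (a.name i))

/-- Entailment in all sufficiently large finite contexts. Once `N` is at least every name involved,
`Fin.ofNat` no longer identifies different names, so the wrap-around at small levels does no harm.
-/
instance : Preorder (NamedFormula L T) where
  le a b := ∀ᶠ N in atTop, Prf T (a.atLevel N →ₚ b.atLevel N)
  le_refl a := Eventually.of_forall fun N => .id _
  le_trans a b c h h' := by filter_upwards [h, h'] with N h h' using .trans h h'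

theorem le_def {a b : NamedFormula L T} :
    a ≤ b ↔ ∀ᶠ N in atTop, Prf T (a.atLevel N →ₚ b.atLevel N) := Iff.rfl

theorem le_of_prf {a b : NamedFormula L T} (h : ∀ N, Prf T (a.atLevel N →ₚ b.atLevel N)) : a ≤ b :=
  Eventually.of_forall h

/-- Conjunction. -/
def and (a b : NamedFormula L T) : NamedFormula L T where
  form := (a.form.subst fun i => vr (Fin.castAdd b.n i)) ∧ₚ
    (b.form.subst fun i => vr (Fin.natAdd a.n i))
  name := Fin.append a.name b.name

theorem and_atLevel (a b : NamedFormula L T) (N : ℕ) : (a.and b).atLevel N = a.atLevel N ∧ₚ b.atLevel N := by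
  simp [atLevel, and, Formula.subst, Formula.subst_subst, Term.subst]

theorem le_and_iff {a b c d : NamedFormula L T} (hc : ∀ N, c.atLevel N = a.atLevel N ∧ₚ b.atLevel N) :
    d ≤ c ↔ d ≤ a ∧ d ≤ b := by
  simp only [le_def, hc]
  refine ⟨fun h => ⟨h.mono fun N h => h.trans (.and_left _ _),
    h.mono fun N h => h.trans (.and_right _ _)⟩, fun h => ?_⟩
  filter_upwards [h.1, h.2] with N h h' using .and_intro h h'

theorem and_le_left (a b : NamedFormula L T) : a.and b ≤ a :=
  ((le_and_iff (and_atLevel a b)).1 le_rfl).1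

theorem and_le_right (a b : NamedFormula L T) : a.and b ≤ b :=
  ((le_and_iff (and_atLevel a b)).1 le_rfl).2

open Nucleus (principal principal_le_principal)

variable {n : ℕ} (name : Fin n → ℕ)

theorem principal_and (φ ψ : Formula L n) :
    principal (⟨φ ∧ₚ ψ, name⟩ : NamedFormula L T) = principal ⟨φ, name⟩ ⊓ principal ⟨ψ, name⟩ :=
  Nucleus.frame_ext fun _ => le_and_iff fun _ => rfl

theorem principal_imp (φ ψ : Formula L n) :
    principal (⟨φ →ₚ ψ, name⟩ : NamedFormula L T) = principal ⟨φ, name⟩ ⇨ principal ⟨ψ, name⟩ := by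
  refine Nucleus.frame_ext fun d => ?_
  rw [Nucleus.mem_himp]
  refine ⟨fun h e hed h' => ?_, fun h => ?_⟩
  · have := hed.trans h
    simp only [Nucleus.mem_principal, le_def] at *
    filter_upwards [this, h'] with N h h' using .imp_mp h h'
  -- The largest refinement of `d` that entails φ is the conjunction of the two; testing on it gives
  -- the deduction theorem.
  · have := h _ (and_le_left d ⟨φ, name⟩) (and_le_right d ⟨φ, name⟩)
    simp only [Nucleus.mem_principal, le_def, and_atLevel] at *
    filter_upwards [this] with N h using .curry h

theorem principal_bot : principal (⟨.bot, name⟩ : NamedFormula L T) = ⊥ :=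
  Nucleus.principal_eq_bot fun _ => le_of_prf fun _ => .bot_elim _

theorem principal_or (φ ψ : Formula L n) :
    principal (⟨φ ∨ₚ ψ, name⟩ : NamedFormula L T) = principal ⟨φ, name⟩ ⊔ principal ⟨ψ, name⟩ := by
  refine Nucleus.principal_eq_sup (le_of_prf fun N => .or_left _ _)
    (le_of_prf fun N => .or_right _ _) fun d hd e he => ?_
  have h₁ := he _ (.inl (and_le_right d ⟨φ, name⟩)) (and_le_left d _)
  have h₂ := he _ (.inr (and_le_right d ⟨ψ, name⟩)) (and_le_left d _)
  simp only [le_def, and_atLevel] at *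
  filter_upwards [hd, h₁, h₂] with N h h₁ h₂
  have swap : ∀ {φ ψ χ : Formula L (N + 1)}, Prf T (φ ∧ₚ ψ →ₚ χ) → Prf T (ψ →ₚ φ →ₚ χ) :=
    fun h => .curry (.trans (.and_intro (.and_right _ _) (.and_left _ _)) h)
  exact .imp_mp (h.trans (.or_elim (swap h₁) (swap h₂))) (.id _)

/-- Moving a variable that does not occur to the front. -/
theorem rename_fresh (hT : Renamable T) (K : ℕ) {M : ℕ} (N : ℕ) {φ : Formula L (M + 1)}
    (h : Prf T φ) :
    Prf T (φ.subst fun i => if (i : ℕ) = K then vr (0 : Fin (N + 2))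
      else vr (Fin.ofNat (N + 1) i).succ) := by
  convert h.rename hT
    (fun i => if (i : ℕ) = K then (0 : Fin (N + 2)) else (Fin.ofNat (N + 1) i).succ) using 3
  split_ifs <;> rfl

theorem atLevel_rename_fresh {K M : ℕ} (hM : K ≤ M) (N : ℕ) (a : NamedFormula L T)
    (ha : ∀ i, a.name i < K) :
    ((a.atLevel M).subst fun i => if (i : ℕ) = K then vr (0 : Fin (N + 2))
      else vr (Fin.ofNat (N + 1) i).succ) = (a.atLevel N).shift := by
  rw [atLevel, Formula.subst_subst, Formula.shift, atLevel, Formula.subst_subst]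
  congr 1
  funext i
  have h := ha i
  simp [Term.subst, Nat.mod_eq_of_lt (show a.name i < M + 1 by omega), h.ne]

theorem atLevel_cons_rename_fresh {K M : ℕ} (hM : K ≤ M) (N : ℕ) (φ : Formula L (n + 1))
    (ha : ∀ i, name i < K) :
    (((⟨φ, Matrix.vecCons K name⟩ : NamedFormula L T).atLevel M).subst fun i =>
      if (i : ℕ) = K then vr (0 : Fin (N + 2)) else vr (Fin.ofNat (N + 1) i).succ) =
    φ.subst (liftSubst fun i => vr (Fin.ofNat (N + 1) (name i))) := by
  rw [atLevel, Formula.subst_subst]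
  congr 1
  funext i
  refine Fin.cases ?_ (fun i => ?_) i
  · simp [Term.subst, Nat.mod_eq_of_lt (show K < M + 1 by omega), liftSubst_zero]
  · have h := ha i
    simp [Term.subst, Nat.mod_eq_of_lt (show name i < M + 1 by omega), h.ne, liftSubst_succ]

theorem exists_fresh (name : Fin n → ℕ) : ∃ K, ∀ i, name i < K :=
  ⟨Finset.univ.sup name + 1, fun i => Nat.lt_succ_of_le (Finset.le_sup (Finset.mem_univ i))⟩

theorem atLevel_cons (x : ℕ) (φ : Formula L (n + 1)) (N : ℕ) :
    (⟨φ, Matrix.vecCons x name⟩ : NamedFormula L T).atLevel N =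
      φ.subst (Fin.cons (vr (Fin.ofNat (N + 1) x)) fun i => vr (Fin.ofNat (N + 1) (name i))) := by
  rw [atLevel]
  congr 1
  funext i
  exact Fin.cases rfl (fun i => rfl) i

theorem principal_all (hT : Renamable T) (φ : Formula L (n + 1)) :
    principal (⟨.all φ, name⟩ : NamedFormula L T) =
      ⨅ x, principal ⟨φ, Matrix.vecCons x name⟩ := by
  refine Nucleus.frame_ext fun d => ?_
  rw [Nucleus.mem_iInf]
  refine ⟨fun h x => ?_, fun h => ?_⟩
  · refine h.trans (le_of_prf fun N => ?_)
    have := Prf.all_elim (T := T) (φ.subst (liftSubst fun i => vr (Fin.ofNat (N + 1) (name i))))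
      (vr (Fin.ofNat (N + 1) x))
    rw [Formula.subst_lift_inst, ← atLevel_cons] at this
    exact .trans (.and_intro (.id _) (.weaken (.eq_refl _))) this
  -- A name `K` fresh for `d` and for the parameters acts as an eigenvariable. Its instance is
  -- derived at a single level `M ≥ K`; renaming `K` to the bound variable then gives the quantified
  -- statement at every level `N`.
  · obtain ⟨K, hK⟩ := exists_fresh (Fin.append d.name name)
    have hd : ∀ i, d.name i < K := fun i => by simpa using hK (Fin.castAdd _ i)
    have hn : ∀ i, name i < K := fun i => by simpa using hK (Fin.natAdd _ i)
    obtain ⟨M, hM, hKM⟩ := ((h K).and (eventually_ge_atTop K)).exists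
    refine le_of_prf fun N => .all_intro ?_
    have := rename_fresh hT K N hM
    rwa [Formula.subst, atLevel_rename_fresh hKM N d hd, atLevel_cons_rename_fresh name hKM N φ hn] at this

theorem principal_ex (hT : Renamable T) (φ : Formula L (n + 1)) :
    principal (⟨.ex φ, name⟩ : NamedFormula L T) =
      ⨆ x, principal ⟨φ, Matrix.vecCons x name⟩ := by
  refine Nucleus.principal_eq_iSup (fun x => le_of_prf fun N => ?_) fun d hd e he => ?_
  · have := Prf.ex_intro (T := T) (φ.subst (liftSubst fun i => vr (Fin.ofNat (N + 1) (name i))))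
      (vr (Fin.ofNat (N + 1) x))
    rw [Formula.subst_lift_inst, ← atLevel_cons] at this
    exact .trans (.and_intro (.id _) (.weaken (.eq_refl _))) this
  · obtain ⟨K, hK⟩ := exists_fresh (Fin.append (Fin.append d.name e.name) name)
    have hd' : ∀ i, d.name i < K := fun i => by
      simpa using hK (Fin.castAdd _ (Fin.castAdd _ i))
    have he' : ∀ i, e.name i < K := fun i => by
      simpa using hK (Fin.castAdd _ (Fin.natAdd _ i))
    have hn : ∀ i, name i < K := fun i => by simpa using hK (Fin.natAdd _ i)
    -- The test element is the conjunction of `d` with the instance at the fresh name. Since `K`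
    -- occurs in neither `d` nor `e`, the derivation becomes an existential elimination.
    have h := he K _ (and_le_right d ⟨φ, Matrix.vecCons K name⟩) (and_le_left d _)
    obtain ⟨M, hM, hKM⟩ := ((NamedFormula.le_def.1 h).and (eventually_ge_atTop K)).exists
    refine (NamedFormula.le_def.1 hd).mono fun N hN => ?_
    have := rename_fresh hT K N hM
    rw [and_atLevel, Formula.subst, Formula.subst, atLevel_rename_fresh hKM N d hd',
      atLevel_rename_fresh hKM N e he', atLevel_cons_rename_fresh name hKM N φ hn] at this
    have h₂ := Prf.curry (.trans (.and_intro (.and_right _ _) (.and_left _ _)) this)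
    exact .imp_mp (hN.trans (.ex_elim (ψ := d.atLevel N →ₚ e.atLevel N) h₂)) (.id _)

end NamedFormula

/-- The frame of truth values generated by the formulas of a theory. -/
abbrev TruthValue {L : FirstOrder.Language.{u, v}} (T : Axioms L) : Type (max u v) :=
  (Nucleus.canonical (NamedFormula L T)).toSublocale

section TermModel

variable {L : FirstOrder.Language.{u, v}} {T : Axioms L}

open Nucleus (principal principal_le_principal)

open NamedFormula

/-- The truth value of a formula whose variables are named by numbers. -/
def truth (T : Axioms L) {n : ℕ} (φ : Formula L n) (v : Fin n → ℕ) : TruthValue T :=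
  principal ⟨φ, v⟩

theorem truth_le {n m : ℕ} {φ : Formula L n} {v : Fin n → ℕ} {ψ : Formula L m} {w : Fin m → ℕ}
    (h : ∀ N, Prf T ((φ.subst fun i => vr (Fin.ofNat (N + 1) (v i))) →ₚ
      (ψ.subst fun i => vr (Fin.ofNat (N + 1) (w i))))) : truth T φ v ≤ truth T ψ w :=
  principal_le_principal.2 (le_of_prf h)

theorem truth_eq_top {n : ℕ} {φ : Formula L n} (hT : Renamable T) (h : Prf T φ) (v : Fin n → ℕ) :
    truth T φ v = ⊤ := by
  refine top_le_iff.1 fun a _ => le_of_prf fun N => .weaken (h.rename hT _)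

theorem prf_of_truth_eq_top (hT : Renamable T) (c : L.Functions 0) {n : ℕ} {φ : Formula L n}
    (h : truth T φ (fun i => i) = ⊤) : Prf T φ := by
  have h₁ : (⟨(.bot →ₚ .bot), Fin.elim0⟩ : NamedFormula L T) ∈ (truth T φ (fun i => i)).1 := by
    rw [h]; trivial
  obtain ⟨N, hN, hn⟩ := ((NamedFormula.le_def.1 h₁).and (eventually_ge_atTop n)).exists
  have h₂ : Prf T (atLevel N (⟨φ, fun i => i⟩ : NamedFormula L T)) := .mp (.id _) hN
  -- φ uses only the first `n` of the `N + 1` variables. The superfluous ones are sent to a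
  -- constant, which denotes even when `n = 0`.
  have h₃ := Prf.subst_den (Γ := (.bot →ₚ .bot : Formula L n)) hT h₂
    (fun i => if h : (i : ℕ) < n then vr ⟨i, h⟩ else Term.func c Fin.elim0) fun i => by
      split_ifs with h
      · exact .weaken (.eq_refl _)
      · exact .weaken (.const_den _ _)
  have h₄ := Prf.mp (.id _) h₃
  rw [atLevel, Formula.subst_subst] at h₄
  convert h₄ using 1
  conv_lhs => rw [← Formula.subst_vr φ]
  congr 1
  funext i
  simp [Term.subst, Nat.mod_eq_of_lt (show (i : ℕ) < N + 1 by omega)]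

/-- The truth value of `t = z`. -/
def truthVal (T : Axioms L) {n : ℕ} (t : Tm L n) (v : Fin n → ℕ) (z : ℕ) : TruthValue T :=
  truth T ((t.subst fun i => vr i.succ) =ₚ vr 0) (Matrix.vecCons z v)

theorem mem_truthVal {n : ℕ} {t : Tm L n} {v : Fin n → ℕ} {z : ℕ} {a : NamedFormula L T} :
    a ∈ (truthVal T t v z).1 ↔ ∀ᶠ N in atTop,
      Prf T (a.atLevel N →ₚ (t.subst fun i => vr (Fin.ofNat (N + 1) (v i))) =ₚ
        vr (Fin.ofNat (N + 1) z)) := by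
  simp only [truthVal, truth, Nucleus.mem_principal, NamedFormula.le_def]
  simp only [atLevel, Formula.subst, Tm.subst_subst, Term.subst, Matrix.cons_val_succ,
    Matrix.cons_val_zero]

/-- The term model of a theory: its elements are variables. -/
def termModel (T : Axioms L) (hT : Renamable T) : FrameModel L (TruthValue T) ℕ where
  eq x y := truthVal T (vr (0 : Fin 1)) ![x] y
  eq_refl x := top_le_iff.1 fun a _ =>
    mem_truthVal.2 (Eventually.of_forall fun N => .weaken (.eq_refl _))
  eq_symm x y a h := by
    have h := mem_truthVal.1 h
    exact mem_truthVal.2 (h.mono fun N h => .tm_symm hT h)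
  eq_trans x y z a h := by
    have h₁ := mem_truthVal.1 h.1
    have h₂ := mem_truthVal.1 h.2
    exact mem_truthVal.2 (h₁.mp (h₂.mono fun N h h' => .tm_trans hT h' h))
  fn F x z := truthVal T (Term.func F vr) x z
  fn_congr F x y z w a h := by
    obtain ⟨⟨h₁, h₂⟩, h₃⟩ := h
    have h₁ := eventually_all.2 fun i => mem_truthVal.1 (Nucleus.mem_iInf.1 h₁ i)
    refine mem_truthVal.2 ?_
    filter_upwards [h₁, mem_truthVal.1 h₂, mem_truthVal.1 h₃] with N h₁ h₂ h₃
    refine .tm_trans hT (.tm_trans hT (.tm_symm hT (.tm_func hT F ?_ ?_)) h₃) h₂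
    · exact h₁
    · exact h₃.trans (.eq_den_left _ _)
  fn_unique F x z w a h := by
    have h₁ := mem_truthVal.1 h.1
    have h₂ := mem_truthVal.1 h.2
    exact mem_truthVal.2 (h₁.mp (h₂.mono fun N h h' => .tm_trans hT (.tm_symm hT h') h))
  const_total c x := by
    -- The join over `z` is the truth value of the formula `∃ z, c = z`, which is provable because
    -- constants denote.
    refine (principal_ex _ hT _).symm.trans (truth_eq_top hT ?_ _)
    refine .mp ?_ (.ex_intro _ (Term.func c Fin.elim0))
    refine .mp (.id (.bot →ₚ .bot)) (.and_intro (.weaken ?_) (.weaken (.const_den _ _)))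
    simp only [Formula.inst, Formula.subst, Term.subst, Fin.cons_zero]
    have key : ∀ f g : Fin 0 → Tm L 0, Prf T (Term.func c f =ₚ Term.func c g) :=
      fun f g => Subsingleton.elim f g ▸ .const_den c f
    exact key _ _

variable {hT : Renamable T}

theorem termModel_val {n : ℕ} (t : Tm L n) (v : Fin n → ℕ) (z : ℕ) :
    (termModel T hT).val t v z = truthVal T t v z := by
  induction t generalizing z with
  | var i => exact Nucleus.frame_ext fun a => mem_truthVal.trans mem_truthVal.symm
  | func F ts ih =>
    simp only [FrameModel.val, ih]
    refine le_antisymm (iSup_le fun w => ?_) ?_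
    · rintro a ⟨h₁, h₂⟩
      have h₁ := eventually_all.2 fun i => mem_truthVal.1 (Nucleus.mem_iInf.1 h₁ i)
      refine mem_truthVal.2 ?_
      filter_upwards [h₁, mem_truthVal.1 h₂] with N h₁ h₂
      refine .tm_trans hT (.tm_symm hT (.tm_func hT F (fun i => .tm_symm hT (h₁ i)) ?_)) h₂
      exact h₂.trans (.eq_den_left _ _)
    -- Strictness makes every argument denote as soon as the whole term does, so the arguments can
    -- be given values that are variables.
    · refine le_of_le_iSup (le_iSup_iInf_fin (a := fun i => truthVal T (ts i) v) fun i => ?_)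
        fun w => le_iSup_of_le w ?_
      · refine le_trans ?_ (principal_ex v hT ((ts i).subst (fun i => vr i.succ) =ₚ vr 0)).le
        refine truth_le fun N => ?_
        refine Prf.trans (.eq_den_left _ _) (.trans (.func_strict _ _ i) ?_)
        refine .trans (.and_intro ?_ (.id _)) (.ex_intro _ _)
        simp only [Formula.inst, Formula.subst, Tm.subst_subst, Term.subst, liftSubst_succ,
          liftSubst_zero, Fin.cons_zero, Fin.cons_succ, Matrix.cons_val_succ]
        exact .id _
      · rintro a ⟨h₁, h₂⟩
        refine ⟨h₂, mem_truthVal.2 ?_⟩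
        have h₂ := eventually_all.2 fun i => mem_truthVal.1 (Nucleus.mem_iInf.1 h₂ i)
        filter_upwards [mem_truthVal.1 h₁, h₂] with N h₁ h₂
        refine .tm_trans hT (.tm_symm hT (.tm_func hT F h₂ ?_)) h₁
        exact h₁.trans (.eq_den_left _ _)

/-- The truth lemma: `principal` carries each connective and quantifier to the matching frame
operation. Atomic formulas need in addition that an equation between terms provides a common value.
-/
theorem termModel_sem [L.IsAlgebraic] {n : ℕ} (φ : Formula L n) (v : Fin n → ℕ) :
    (termModel T hT).sem φ v = truth T φ v := by
  induction φ with
  | bot => exact (principal_bot v).symm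
  | equal s t =>
    simp only [FrameModel.sem_equal, termModel_val]
    refine le_antisymm (iSup_le fun z => ?_) ?_
    · rintro a ⟨h₁, h₂⟩
      have h₁ := mem_truthVal.1 h₁
      have h₂ := mem_truthVal.1 h₂
      exact h₁.mp (h₂.mono fun N h h' => .tm_trans hT h' (.tm_symm hT h))
    · refine le_trans ?_ ((principal_ex v hT ((s.subst (fun i => vr i.succ) =ₚ vr 0) ∧ₚ
        (t.subst (fun i => vr i.succ) =ₚ vr 0))).le.trans (iSup_mono fun z =>
          (principal_and _ _ _).le))
      refine truth_le fun N => ?_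
      refine .trans (.and_intro ?_ (.eq_den_right _ _)) (.ex_intro _ _)
      simp only [Formula.inst, Formula.subst, Tm.subst_subst, Term.subst, liftSubst_succ,
          liftSubst_zero, Fin.cons_zero, Fin.cons_succ]
      exact .and_intro (.id _) (.eq_den_right _ _)
  | rel R ts => exact isEmptyElim R
  | and φ ψ ih₁ ih₂ => exact (congr_arg₂ _ (ih₁ v) (ih₂ v)).trans (principal_and v φ ψ).symm
  | or φ ψ ih₁ ih₂ => exact (congr_arg₂ _ (ih₁ v) (ih₂ v)).trans (principal_or v φ ψ).symm
  | imp φ ψ ih₁ ih₂ => exact (congr_arg₂ _ (ih₁ v) (ih₂ v)).trans (principal_imp v φ ψ).symm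
  | all φ ih => exact (iInf_congr fun x => ih _).trans (principal_all v hT φ).symm
  | ex φ ih => exact (iSup_congr fun x => ih _).trans (principal_ex v hT φ).symm

end TermModel

end LPT

/-! ### The axioms of HAP are closed under renaming of variables. -/

instance langHAP_isAlgebraic : langHAP.IsAlgebraic := fun _ => inferInstanceAs (IsEmpty Empty)

instance langF_isAlgebraic : langF.IsAlgebraic := fun _ => inferInstanceAs (IsEmpty Empty)

namespace HAP

open FirstOrder.Language (Term)

variable {n m : ℕ} (σ : Fin n → Tm langHAP m)

theorem cst_subst (c : HAPFunc 0) : (cst c : Tm langHAP n).subst σ = cst c := by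
  simp only [cst, FirstOrder.Language.Constants.term, Term.subst]
  exact congr_arg _ (Subsingleton.elim _ _)

theorem S_subst (t : Tm langHAP n) : (S t).subst σ = S (t.subst σ) := by
  simp only [S, FirstOrder.Language.Functions.apply₁, Term.subst]
  exact congr_arg _ (funext fun i => by fin_cases i; rfl)

theorem add_subst (t u : Tm langHAP n) : (t +ₚ u).subst σ = t.subst σ +ₚ u.subst σ := by
  simp only [add, FirstOrder.Language.Functions.apply₂, Term.subst]
  exact congr_arg _ (funext fun i => by fin_cases i <;> rfl)

theorem mul_subst (t u : Tm langHAP n) : (t ×ₚ u).subst σ = t.subst σ ×ₚ u.subst σ := by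
  simp only [mul, FirstOrder.Language.Functions.apply₂, Term.subst]
  exact congr_arg _ (funext fun i => by fin_cases i <;> rfl)

theorem app_subst (t u : Tm langHAP n) : (t ·ₚ u).subst σ = t.subst σ ·ₚ u.subst σ := by
  simp only [app, FirstOrder.Language.Functions.apply₂, Term.subst]
  exact congr_arg _ (funext fun i => by fin_cases i <;> rfl)

theorem vr_subst (i : Fin n) : (vr i).subst σ = σ i := rfl

theorem Basic.rename {φ : Formula langHAP n} (h : Basic φ) (ρ : Fin n → Fin m) :
    Basic (φ.subst fun i => vr (ρ i)) := by
  cases h <;>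
    simp only [den, simeq, Formula.subst, cst_subst, S_subst, add_subst, mul_subst, app_subst,
      vr_subst] <;>
    constructor

theorem renamable : Renamable HAP := by
  intro n m φ ρ h
  cases h with
  | basic h => exact .basic (h.rename ρ)
  | ind χ =>
    exact (congrArg (· ∈ HAP m) (Formula.inductionAxiom_subst (L := langHAP) HAPFunc.zero
      HAPFunc.succ χ fun i => vr (ρ i))).mpr (HAPAx.ind _)

end HAP

namespace LPT.FrameModel

open FirstOrder.Language (Term)

/-! ### Induction in a model -/

section Induction

universe u v w x

variable {L : FirstOrder.Language.{u, v}} {H : Type w} [Order.Frame H] {D : Type x}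
  {M : FrameModel L H D}

theorem val_constant (c : L.Functions 0) {n : ℕ} (v : Fin n → D) (z : D) :
    M.val (FirstOrder.Language.Constants.term c) v z = M.fn c ![] z := by
  simp only [FirstOrder.Language.Constants.term, val, iInf_of_empty, top_inf_eq]
  exact le_antisymm (iSup_le fun w => by rw [Subsingleton.elim w (![] : Fin 0 → D)]) (le_iSup_of_le ![] le_rfl)

theorem val_apply₁ (F : L.Functions 1) {n : ℕ} (t : Tm L n) (v : Fin n → D) (z : D) :
    M.val (F.apply₁ t) v z = ⨆ x, M.val t v x ⊓ M.fn F ![x] z := by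
  simp only [FirstOrder.Language.Functions.apply₁, val]
  refine le_antisymm (iSup_le fun w => le_iSup_of_le (w 0) ?_)
    (iSup_le fun x => le_iSup_of_le ![x] ?_)
  · rw [show ![w 0] = w from funext fun i => by fin_cases i; rfl]
    exact inf_le_inf_right _ (iInf_le _ 0)
  · exact inf_le_inf_right _ (le_iInf fun i => by fin_cases i; exact le_rfl)

theorem val_apply₂ (F : L.Functions 2) {n : ℕ} (t u : Tm L n) (v : Fin n → D) (z : D) :
    M.val (F.apply₂ t u) v z = ⨆ x, ⨆ y, M.val t v x ⊓ M.val u v y ⊓ M.fn F ![x, y] z := by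
  simp only [FirstOrder.Language.Functions.apply₂, val]
  refine le_antisymm (iSup_le fun w => le_iSup_of_le (w 0) (le_iSup_of_le (w 1) ?_))
    (iSup_le fun x => iSup_le fun y => le_iSup_of_le ![x, y] ?_)
  · rw [show ![w 0, w 1] = w from funext fun i => by fin_cases i <;> rfl]
    exact inf_le_inf_right _ (le_inf (iInf_le _ 0) (iInf_le _ 1))
  · refine inf_le_inf_right _ (le_iInf fun i => ?_)
    fin_cases i
    · exact inf_le_left
    · exact inf_le_right

theorem val_apply₁_vr (F : L.Functions 1) {n : ℕ} (i : Fin n) (v : Fin n → D) (z : D) :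
    M.val (F.apply₁ (vr i)) v z = M.fn F ![v i] z := by
  have h := val_func_vr (M := M) F ![i] v z
  rw [show (fun l => v (![i] l)) = ![v i] from funext fun l => by fin_cases l; rfl] at h
  rw [← h]
  exact congrArg (fun ts => M.val (Term.func F ts) v z) (funext fun l => by fin_cases l; rfl)

theorem val_apply₂_vr (F : L.Functions 2) {n : ℕ} (i j : Fin n) (v : Fin n → D) (z : D) :
    M.val (F.apply₂ (vr i) (vr j)) v z = M.fn F ![v i, v j] z := by
  have h := val_func_vr (M := M) F ![i, j] v z
  rw [show (fun l => v (![i, j] l)) = ![v i, v j] from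
    funext fun l => by fin_cases l <;> rfl] at h
  rw [← h]
  exact congrArg (fun ts => M.val (Term.func F ts) v z) (funext fun l => by fin_cases l <;> rfl)

variable [L.IsAlgebraic] (zero : L.Functions 0) (succ : L.Functions 1)

/-- Induction for a predicate with truth values. -/
def Inductive (M : FrameModel L H D) (A : D → H) : Prop :=
  ∀ u : H, (∀ z, u ⊓ M.fn zero ![] z ≤ A z) →
    (∀ x y, u ⊓ A x ⊓ M.fn succ ![x] y ≤ A y) → ∀ x, u ≤ A x

theorem sem_succ_subst {n : ℕ} (χ : Formula L (n + 1)) (x y : D) (v : Fin n → D) :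
    M.fn succ ![x] y ⊓ M.sem (χ.subst (Fin.cons (succ.apply₁ (vr 0)) fun i => vr i.succ))
        (Matrix.vecCons x v) =
      M.fn succ ![x] y ⊓ M.sem χ (Matrix.vecCons y v) := by
  refine sem_subst (fun i => ?_) χ
  refine Fin.cases ?_ (fun i => le_top.trans (M.eq_refl _).ge) i
  rw [Fin.cons_zero, val_apply₁]
  exact le_iSup_of_le x (le_inf (le_top.trans (M.eq_refl _).ge) le_rfl)

theorem sem_inductionAxiom {n : ℕ} {χ : Formula L (n + 1)} {v : Fin n → D}
    (h : M.Inductive zero succ fun x => M.sem χ (Matrix.vecCons x v)) :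
    M.sem (inductionAxiom zero succ χ) v = ⊤ := by
  refine sem_imp_eq_top.2 (le_iInf fun x => h _ (fun z => ?_) (fun x y => ?_) x)
  · rw [sem_and, inf_comm, ← inf_assoc, ← val_constant zero v z, sem_inst]
    exact inf_le_left.trans inf_le_right
  · exact le_trans (le_inf inf_le_right (inf_le_left.trans
      (le_himp_iff.1 (inf_le_right.trans (iInf_le _ x)))))
      ((sem_succ_subst succ χ x y v).le.trans inf_le_right)

/-- The converse passage, from the truth of an induction axiom to a rule usable at any stage.
Totality of successor is needed to turn the relational step `S x = y` into a substitution of the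
term `S x`. -/
theorem inductive_of_sem (hS : ∀ x, ⨆ y, M.fn succ ![x] y = ⊤) {n : ℕ} {χ : Formula L (n + 1)}
    {v : Fin n → D} (h : M.sem (inductionAxiom zero succ χ) v = ⊤) :
    M.Inductive zero succ fun x => M.sem χ (Matrix.vecCons x v) := by
  intro u h₀ hs x
  refine le_trans (le_trans (le_inf ?_ (le_iInf fun x => ?_)) (sem_imp_eq_top.1 h)) (iInf_le _ x)
  · refine le_of_le_iSup (le_top.trans (M.const_total zero ![]).ge) fun z => ?_
    rw [← val_constant zero v z]
    refine le_trans (le_inf inf_le_right ((h₀ z).trans' ?_)) ((sem_inst χ _ z v).ge.trans inf_le_right)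
    rw [val_constant]
  · refine le_himp_iff.2 (le_of_le_iSup (le_top.trans (hS x).ge) fun y => ?_)
    exact le_trans (le_inf inf_le_right (hs x y)) ((sem_succ_subst succ χ x y v).ge.trans inf_le_right)

end Induction

end LPT.FrameModel

namespace LPT.FrameModel

open FirstOrder.Language (Term)

universe u v w x

/-! ### Definable predicates -/

section Definable

variable {L : FirstOrder.Language.{u, v}} [L.IsAlgebraic] {H : Type w} [Order.Frame H]
  {D : Type x} {M : FrameModel L H D} {n m : ℕ}

/-- A predicate with truth values is definable if it is given by a formula. -/
def Definable (M : FrameModel L H D) (A : (Fin n → D) → H) : Prop :=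
  ∃ φ : Formula L n, ∀ v, M.sem φ v = A v

namespace Definable

theorem sem (φ : Formula L n) : M.Definable (M.sem φ) := ⟨φ, fun _ => rfl⟩

theorem rename {A : (Fin n → D) → H} (h : M.Definable A) (ρ : Fin n → Fin m) :
    M.Definable fun v => A fun i => v (ρ i) := by
  obtain ⟨φ, hφ⟩ := h
  exact ⟨φ.subst fun i => vr (ρ i), fun v => by rw [sem_rename, hφ]⟩

theorem bot : M.Definable fun _ : Fin n → D => ⊥ := ⟨.bot, fun _ => rfl⟩

theorem inf {A B : (Fin n → D) → H} (hA : M.Definable A) (hB : M.Definable B) :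
    M.Definable fun v => A v ⊓ B v := by
  obtain ⟨φ, hφ⟩ := hA
  obtain ⟨ψ, hψ⟩ := hB
  exact ⟨φ ∧ₚ ψ, fun v => by rw [sem_and, hφ, hψ]⟩

theorem sup {A B : (Fin n → D) → H} (hA : M.Definable A) (hB : M.Definable B) :
    M.Definable fun v => A v ⊔ B v := by
  obtain ⟨φ, hφ⟩ := hA
  obtain ⟨ψ, hψ⟩ := hB
  exact ⟨φ ∨ₚ ψ, fun v => by rw [sem_or, hφ, hψ]⟩

theorem himp {A B : (Fin n → D) → H} (hA : M.Definable A) (hB : M.Definable B) :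
    M.Definable fun v => A v ⇨ B v := by
  obtain ⟨φ, hφ⟩ := hA
  obtain ⟨ψ, hψ⟩ := hB
  exact ⟨φ →ₚ ψ, fun v => by rw [sem_imp, hφ, hψ]⟩

theorem iInf {A : D → (Fin n → D) → H}
    (h : M.Definable fun v : Fin (n + 1) → D => A (v 0) fun i => v i.succ) :
    M.Definable fun v => ⨅ x, A x v := by
  obtain ⟨φ, hφ⟩ := h
  exact ⟨.all φ, fun v => iInf_congr fun x => hφ _⟩

theorem iSup {A : D → (Fin n → D) → H}
    (h : M.Definable fun v : Fin (n + 1) → D => A (v 0) fun i => v i.succ) :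
    M.Definable fun v => ⨆ x, A x v := by
  obtain ⟨φ, hφ⟩ := h
  exact ⟨.ex φ, fun v => iSup_congr fun x => hφ _⟩

theorem eq (i j : Fin n) : M.Definable fun v => M.eq (v i) (v j) :=
  ⟨vr i =ₚ vr j, fun v => sem_var_eq i j v⟩

theorem val (t : Tm L n) (j : Fin n) : M.Definable fun v => M.val t v (v j) := by
  refine ⟨t =ₚ vr j, fun v => ?_⟩
  refine le_antisymm (iSup_le fun z => ?_)
    (le_iSup_of_le (v j) (le_inf le_rfl (le_top.trans (M.eq_refl _).ge)))
  rw [inf_comm]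
  exact (inf_le_inf_right _ (M.eq_symm _ _)).trans (val_congr _ _ _ _)

theorem fn {k : ℕ} (F : L.Functions k) (ρ : Fin k → Fin n) (j : Fin n) :
    M.Definable fun v => M.fn F (fun i => v (ρ i)) (v j) := by
  simpa only [val_func_vr] using val (M := M) (Term.func F fun i => vr (ρ i)) j

end Definable

end Definable

/-! ### Terms that denote -/

section Denotation

variable {L : FirstOrder.Language.{u, v}} {H : Type w} [Order.Frame H]
  {D : Type x} {M : FrameModel L H D} {n m : ℕ}

/-- The truth value of `t ↓`. -/
def denotes (M : FrameModel L H D) (t : Tm L n) (v : Fin n → D) : H := ⨆ z, M.val t v z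

theorem denotes_vr (i : Fin n) (v : Fin n → D) : M.denotes (vr i) v = ⊤ :=
  top_le_iff.1 (le_iSup_of_le (v i) (M.eq_refl _).ge)

theorem val_le_denotes (t : Tm L n) (v : Fin n → D) (z : D) : M.val t v z ≤ M.denotes t v :=
  le_iSup _ z

theorem val_le_of_sem_equal [L.IsAlgebraic] {s t : Tm L n} {v : Fin n → D} {u : H} (h : u ≤ M.sem (s =ₚ t) v)
    (z : D) : u ⊓ M.val s v z ≤ M.val t v z := by
  refine le_of_le_iSup (inf_le_left.trans h) fun y => ?_
  refine le_trans (le_inf ?_ (inf_le_right.trans inf_le_right)) (val_congr t v y z)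
  exact le_trans (le_inf (inf_le_right.trans inf_le_left) (inf_le_left.trans inf_le_right))
    (val_unique s v y z)

theorem val_eq_of_sem_equal [L.IsAlgebraic] {s t : Tm L n} {v : Fin n → D} (h : M.sem (s =ₚ t) v = ⊤) :
    M.val s v = M.val t v := by
  have h' : M.sem (t =ₚ s) v = ⊤ := by
    rw [← h, sem_equal, sem_equal]
    exact iSup_congr fun z => inf_comm _ _
  funext z
  exact le_antisymm (by simpa using val_le_of_sem_equal h.ge z)
    (by simpa using val_le_of_sem_equal h'.ge z)

theorem val_eq_of_sem_simeq [L.IsAlgebraic] {s t : Tm L n} {v : Fin n → D} (h : M.sem (s ≃ₚ t) v = ⊤) :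
    M.val s v = M.val t v := by
  have h₁ := sem_imp_eq_top.1 h
  rw [sem_or, sem_den, sem_den] at h₁
  have h₂ : M.denotes t v ≤ M.sem (t =ₚ s) v :=
    (le_sup_right.trans h₁).trans (iSup_mono fun z => (inf_comm _ _).le)
  funext z
  refine le_antisymm ?_ ?_
  · exact (le_inf (val_le_denotes s v z) le_rfl).trans
      (val_le_of_sem_equal (le_sup_left.trans h₁) z)
  · exact (le_inf (val_le_denotes t v z) le_rfl).trans (val_le_of_sem_equal h₂ z)

/-- An equation between terms may be instantiated at terms that denote. -/
theorem val_subst_congr {s t : Tm L n} (h : ∀ w : Fin n → D, M.val s w = M.val t w)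
    (σ : Fin n → Tm L m) (v : Fin m → D) (z : D) :
    (⨅ i, M.denotes (σ i) v) ⊓ M.val (s.subst σ) v z =
      (⨅ i, M.denotes (σ i) v) ⊓ M.val (t.subst σ) v z := by
  have aux : ∀ {s t : Tm L n}, (∀ w : Fin n → D, M.val s w = M.val t w) →
      (⨅ i, M.denotes (σ i) v) ⊓ M.val (s.subst σ) v z ≤ M.val (t.subst σ) v z := by
    intro s t h
    refine le_of_le_iSup (inf_le_left.trans (le_iSup_iInf_fin (a := fun i => M.val (σ i) v)
      fun i => iInf_le _ i)) fun w => ?_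
    have hw := fun t : Tm L n =>
      val_subst (M := M) (u := ⨅ i, M.val (σ i) v (w i)) (fun i => iInf_le _ i) t z
    refine le_trans (le_inf inf_le_right (inf_le_left.trans inf_le_right)) ?_
    rw [hw s, h, ← hw t]
    exact inf_le_right
  exact le_antisymm (le_inf inf_le_left (aux h)) (le_inf inf_le_left (aux fun w => (h w).symm))

end Denotation

end LPT.FrameModel

namespace LPT.FrameModel

open FirstOrder.Language (Term)

open HAP (S k s r sc zero cst)

universe w x

/-! ### Models of HAP -/

section HAPModel

variable {H : Type w} [Order.Frame H] {D : Type x} {M : FrameModel langHAP H D} {n m : ℕ}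

/-- All axioms of HAP hold. -/
def IsHAPModel (M : FrameModel langHAP H D) : Prop :=
  ∀ n, ∀ φ ∈ HAP n, ∀ v, M.sem φ v = ⊤

/-- The truth value of `z = 0`. -/
def isZero (M : FrameModel langHAP H D) (z : D) : H := M.fn (k := 0) HAPFunc.zero ![] z

/-- The truth value of `S x = y`. -/
def isSucc (M : FrameModel langHAP H D) (x y : D) : H := M.fn (k := 1) HAPFunc.succ ![x] y

/-- The truth value of `x y = z`. -/
def isApp (M : FrameModel langHAP H D) (x y z : D) : H := M.fn (k := 2) HAPFunc.app ![x, y] z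

theorem val_cst (c : HAPFunc 0) (v : Fin n → D) (z : D) :
    M.val (cst c) v z = M.fn (k := 0) c ![] z := val_constant (L := langHAP) c v z

theorem val_S (t : Tm langHAP n) (v : Fin n → D) (z : D) :
    M.val (S t) v z = ⨆ x, M.val t v x ⊓ M.isSucc x z :=
  val_apply₁ (L := langHAP) HAPFunc.succ t v z

theorem val_S_vr (i : Fin n) (v : Fin n → D) (z : D) :
    M.val (S (vr i)) v z = M.isSucc (v i) z :=
  val_apply₁_vr (L := langHAP) HAPFunc.succ i v z

theorem val_app (t u : Tm langHAP n) (v : Fin n → D) (z : D) :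
    M.val (t ·ₚ u) v z = ⨆ x, ⨆ y, M.val t v x ⊓ M.val u v y ⊓ M.isApp x y z :=
  val_apply₂ (L := langHAP) HAPFunc.app t u v z

theorem val_app_vr (i j : Fin n) (v : Fin n → D) (z : D) :
    M.val (vr i ·ₚ vr j) v z = M.isApp (v i) (v j) z :=
  val_apply₂_vr (L := langHAP) HAPFunc.app i j v z

theorem val_app_congr {t u t' u' : Tm langHAP n} {v : Fin n → D} (h : M.val t v = M.val t' v)
    (h' : M.val u v = M.val u' v) : M.val (t ·ₚ u) v = M.val (t' ·ₚ u') v := by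
  funext z
  simp only [val_app, h, h']

theorem isSucc_unique {u : H} {x y z : D} (h : u ≤ M.isSucc x y) (h' : u ≤ M.isSucc x z) :
    u ≤ M.eq y z := (le_inf h h').trans (M.fn_unique _ _ _ _)

theorem isApp_unique {u : H} {x y z w : D} (h : u ≤ M.isApp x y z) (h' : u ≤ M.isApp x y w) :
    u ≤ M.eq z w := (le_inf h h').trans (M.fn_unique _ _ _ _)

theorem le_eq_symm {u : H} {x y : D} (h : u ≤ M.eq x y) : u ≤ M.eq y x := h.trans (M.eq_symm _ _)

theorem le_eq_refl (u : H) (x : D) : u ≤ M.eq x x := le_top.trans (M.eq_refl x).ge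

theorem isSucc_congr {u : H} {x y x' y' : D} (hx : u ≤ M.eq x x') (hy : u ≤ M.eq y y')
    (h : u ≤ M.isSucc x y) : u ≤ M.isSucc x' y' :=
  (le_inf (le_inf (le_iInf fun i => by fin_cases i; exact hx) hy) h).trans (M.fn_congr _ _ _ _ _)

theorem isApp_congr {u : H} {x y z x' y' z' : D} (hx : u ≤ M.eq x x') (hy : u ≤ M.eq y y')
    (hz : u ≤ M.eq z z') (h : u ≤ M.isApp x y z) : u ≤ M.isApp x' y' z' := by
  refine (le_inf (le_inf (le_iInf fun i => ?_) hz) h).trans (M.fn_congr _ _ _ _ _)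
  fin_cases i
  exacts [hx, hy]

theorem isApp_of_val {u : H} {s t : Tm langHAP n} {v : Fin n → D} {x y z : D}
    (hs : u ≤ M.val s v x) (ht : u ≤ M.val t v y) (h : u ≤ M.val (s ·ₚ t) v z) :
    u ≤ M.isApp x y z := by
  rw [val_app] at h
  refine iSup_elim h fun x' u hu h => iSup_elim h fun y' u' hu' h => ?_
  have hu := hu'.trans hu
  refine isApp_congr ?_ ?_ (le_eq_refl _ _) (h.trans inf_le_right)
  · exact (le_inf (h.trans (inf_le_left.trans inf_le_left)) (hu.trans hs)).trans
      (val_unique _ _ _ _)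
  · exact (le_inf (h.trans (inf_le_left.trans inf_le_right)) (hu.trans ht)).trans
      (val_unique _ _ _ _)

theorem val_of_isApp {u : H} {s t : Tm langHAP n} {v : Fin n → D} {x y z : D}
    (hs : u ≤ M.val s v x) (ht : u ≤ M.val t v y) (h : u ≤ M.isApp x y z) :
    u ≤ M.val (s ·ₚ t) v z := by
  rw [val_app]
  exact le_iSup_of_le x (le_iSup_of_le y (le_inf (le_inf hs ht) h))

theorem denotes_app_left (t u : Tm langHAP n) (v : Fin n → D) :
    M.denotes (t ·ₚ u) v ≤ M.denotes t v := by
  simp only [denotes, val_app]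
  exact iSup_le fun z => iSup_le fun x => iSup_le fun y =>
    (inf_le_left.trans inf_le_left).trans (le_iSup _ x)

theorem denotes_app_right (t u : Tm langHAP n) (v : Fin n → D) :
    M.denotes (t ·ₚ u) v ≤ M.denotes u v := by
  simp only [denotes, val_app]
  exact iSup_le fun z => iSup_le fun x => iSup_le fun y =>
    (inf_le_left.trans inf_le_right).trans (le_iSup _ y)

theorem denotes_cst (c : HAPFunc 0) (v : Fin n → D) : M.denotes (cst c) v = ⊤ := by
  simp only [denotes, val_cst]
  exact M.const_total _ _

/-- The truth value of: `e` is a total operation. -/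
def total (M : FrameModel langHAP H D) (e : D) : H := ⨅ z, ⨆ w, M.isApp e z w

/-- The truth value of: `e'` maps `x` to `y`, and agrees with `e` elsewhere. -/
def updates (M : FrameModel langHAP H D) (e x y e' : D) : H :=
  M.isApp e' x y ⊓ ⨅ z, (M.eq z x ⊔ ⨆ w, M.isApp e z w ⊓ M.isApp e' z w)

theorem total_of_updates {u : H} {e x y e' : D} (h : u ≤ updates M e x y e') :
    u ≤ total M e' := by
  refine le_iInf fun z => sup_elim (h.trans (inf_le_right.trans (iInf_le _ z)))
    (fun u' hu' hz => ?_) (fun u' hu' hz => ?_)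
  · exact le_iSup_of_le y (isApp_congr (le_eq_refl _ _) (le_eq_symm hz) (le_eq_refl _ _)
      (hu'.trans (h.trans inf_le_left)))
  · exact hz.trans (iSup_mono fun w => inf_le_right)

theorem Definable.isZero (i : Fin n) : M.Definable fun v => M.isZero (v i) := by
  have h := Definable.val (M := M) zero i
  simp only [zero, val_cst] at h
  exact h

theorem Definable.isSucc (i j : Fin n) : M.Definable fun v => M.isSucc (v i) (v j) := by
  simpa only [val_S_vr] using Definable.val (M := M) (S (vr i)) j

theorem Definable.isApp (i j l : Fin n) : M.Definable fun v => M.isApp (v i) (v j) (v l) := by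
  simpa only [val_app_vr] using Definable.val (M := M) (vr i ·ₚ vr j) l

namespace IsHAPModel

theorem basic (hM : M.IsHAPModel) {φ : Formula langHAP n} (h : HAP.Basic φ) (v : Fin n → D) :
    M.sem φ v = ⊤ := hM n φ (.basic h) v

theorem isSucc_total (hM : M.IsHAPModel) (x : D) : ⨆ y, M.isSucc x y = ⊤ := by
  have h := hM.basic (.succ_den (0 : Fin 1)) ![x]
  rw [sem_den] at h
  simpa only [val_S_vr, Matrix.cons_val_zero] using h

theorem isSucc_injective (hM : M.IsHAPModel) {u : H} {x y z : D} (h : u ≤ M.isSucc x z)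
    (h' : u ≤ M.isSucc y z) : u ≤ M.eq x y := by
  have h₀ := sem_imp_eq_top.1 (hM.basic (.succ_inj (0 : Fin 2) 1) ![x, y])
  rw [sem_var_eq, sem_equal] at h₀
  simp only [val_S_vr] at h₀
  exact (le_iSup_of_le z (le_inf h h')).trans h₀

theorem isZero_isSucc (hM : M.IsHAPModel) {u : H} {x z : D} (h : u ≤ M.isZero z)
    (h' : u ≤ M.isSucc x z) : u ≤ ⊥ := by
  have h₀ := sem_imp_eq_top.1 (hM.basic (.zero_ne_succ (0 : Fin 1)) ![x])
  rw [sem_bot, sem_equal] at h₀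
  simp only [val_S_vr, zero, val_cst] at h₀
  exact (le_iSup_of_le z (le_inf h h')).trans h₀

theorem induction (hM : M.IsHAPModel) {A : (Fin (n + 1) → D) → H} (hA : M.Definable A)
    (v : Fin n → D) {u : H} (h₀ : ∀ z, u ⊓ M.isZero z ≤ A (Matrix.vecCons z v))
    (hs : ∀ x y, u ⊓ A (Matrix.vecCons x v) ⊓ M.isSucc x y ≤ A (Matrix.vecCons y v)) (x : D) :
    u ≤ A (Matrix.vecCons x v) := by
  obtain ⟨φ, hφ⟩ := hA
  simp only [← hφ] at h₀ hs ⊢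
  exact inductive_of_sem (L := langHAP) HAPFunc.zero HAPFunc.succ hM.isSucc_total
    (hM n _ (.ind φ) v) u h₀ hs x

theorem val_k (hM : M.IsHAPModel) (a b : Tm langHAP n) (v : Fin n → D) (z : D) :
    M.val (k ·ₚ a ·ₚ b) v z = M.val a v z ⊓ M.denotes b v := by
  have h := val_subst_congr (fun w => val_eq_of_sem_equal (hM.basic (.k_eq (0 : Fin 2) 1) w))
    ![a, b] v z
  simp only [HAP.app_subst, HAP.cst_subst, HAP.vr_subst, Matrix.cons_val_zero,
    Matrix.cons_val_one] at h
  -- By strictness `k a b` has a value only where `a` and `b` denote, so the guard disappears on the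
  -- left; on the right it leaves `denotes b`.
  rw [inf_eq_right.2] at h
  · rw [h]
    refine le_antisymm (le_inf inf_le_right (inf_le_left.trans (iInf_le _ 1)))
      (le_inf (le_iInf fun i => ?_) inf_le_left)
    fin_cases i
    exacts [inf_le_left.trans (val_le_denotes _ _ _), inf_le_right]
  · refine (val_le_denotes _ _ _).trans (le_iInf fun i => ?_)
    fin_cases i
    exacts [(denotes_app_left _ _ _).trans (denotes_app_right _ _ _), denotes_app_right _ _ _]

theorem val_s (hM : M.IsHAPModel) (a b c : Tm langHAP n) (v : Fin n → D) :
    M.val (s ·ₚ a ·ₚ b ·ₚ c) v = M.val (a ·ₚ c ·ₚ (b ·ₚ c)) v := by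
  funext z
  have h := val_subst_congr (fun w => val_eq_of_sem_simeq (hM.basic (.s_eq (0 : Fin 3) 1 2) w))
    ![a, b, c] v z
  simp only [HAP.app_subst, HAP.cst_subst, HAP.vr_subst, Matrix.cons_val_zero,
    Matrix.cons_val_one, Matrix.cons_val] at h
  -- All of `a`, `b`, `c` occur strictly on both sides, so both guards disappear.
  rwa [inf_eq_right.2, inf_eq_right.2] at h
  · refine (val_le_denotes _ _ _).trans (le_iInf fun i => ?_)
    fin_cases i
    · exact (denotes_app_left _ _ _).trans (denotes_app_left _ _ _)
    · exact (denotes_app_right _ _ _).trans (denotes_app_left _ _ _)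
    · exact (denotes_app_left _ _ _).trans (denotes_app_right _ _ _)
  · refine (val_le_denotes _ _ _).trans (le_iInf fun i => ?_)
    fin_cases i
    · exact (denotes_app_left _ _ _).trans
        ((denotes_app_left _ _ _).trans (denotes_app_right _ _ _))
    · exact (denotes_app_left _ _ _).trans (denotes_app_right _ _ _)
    · exact denotes_app_right _ _ _

theorem val_r_zero (hM : M.IsHAPModel) (a b : Tm langHAP n) (v : Fin n → D) (z : D) :
    M.val (r ·ₚ a ·ₚ b ·ₚ zero) v z = M.val a v z ⊓ M.denotes b v := by
  have h := val_subst_congr (fun w => val_eq_of_sem_equal (hM.basic (.r_zero (0 : Fin 2) 1) w))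
    ![a, b] v z
  simp only [HAP.app_subst, HAP.cst_subst, HAP.vr_subst, Matrix.cons_val_zero,
    Matrix.cons_val_one] at h
  rw [inf_eq_right.2] at h
  · rw [h]
    refine le_antisymm (le_inf inf_le_right (inf_le_left.trans (iInf_le _ 1)))
      (le_inf (le_iInf fun i => ?_) inf_le_left)
    fin_cases i
    exacts [inf_le_left.trans (val_le_denotes _ _ _), inf_le_right]
  · refine (val_le_denotes _ _ _).trans ((denotes_app_left _ _ _).trans (le_iInf fun i => ?_))
    fin_cases i
    exacts [(denotes_app_left _ _ _).trans (denotes_app_right _ _ _), denotes_app_right _ _ _]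

theorem val_r_succ (hM : M.IsHAPModel) (a b c : Tm langHAP n) (v : Fin n → D) :
    M.val (r ·ₚ a ·ₚ b ·ₚ S c) v = M.val (b ·ₚ c ·ₚ (r ·ₚ a ·ₚ b ·ₚ c)) v := by
  have hS : M.denotes (S c) v ≤ M.denotes c v := by
    simp only [denotes, val_S]
    exact iSup_le fun z => iSup_le fun x => inf_le_left.trans (le_iSup _ x)
  funext z
  have h := val_subst_congr (fun w => val_eq_of_sem_simeq (hM.basic (.r_succ (0 : Fin 3) 1 2) w))
    ![a, b, c] v z
  simp only [HAP.app_subst, HAP.cst_subst, HAP.S_subst, HAP.vr_subst, Matrix.cons_val_zero,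
    Matrix.cons_val_one, Matrix.cons_val] at h
  rwa [inf_eq_right.2, inf_eq_right.2] at h
  · refine (val_le_denotes _ _ _).trans (le_iInf fun i => ?_)
    fin_cases i
    · exact (denotes_app_right _ _ _).trans ((denotes_app_left _ _ _).trans
        ((denotes_app_left _ _ _).trans (denotes_app_right _ _ _)))
    · exact (denotes_app_left _ _ _).trans (denotes_app_left _ _ _)
    · exact (denotes_app_left _ _ _).trans (denotes_app_right _ _ _)
  · refine (val_le_denotes _ _ _).trans (le_iInf fun i => ?_)
    fin_cases i
    · exact (denotes_app_left _ _ _).trans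
        ((denotes_app_left _ _ _).trans (denotes_app_right _ _ _))
    · exact (denotes_app_left _ _ _).trans (denotes_app_right _ _ _)
    · exact (denotes_app_right _ _ _).trans hS

theorem val_sc (hM : M.IsHAPModel) (i : Fin n) (v : Fin n → D) :
    M.val (sc ·ₚ vr i) v = M.val (S (vr i)) v :=
  val_eq_of_sem_equal (hM.basic (.sc_eq i) v)

theorem denotes_k (hM : M.IsHAPModel) {a : Tm langHAP n} {v : Fin n → D}
    (ha : M.denotes a v = ⊤) : M.denotes (k ·ₚ a) v = ⊤ := by
  -- No axiom says that `k a` denotes, but it is a subterm of `k a a`, whose value is that of `a`.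
  refine top_le_iff.1 (le_trans ?_ (denotes_app_left (k ·ₚ a) a v))
  rw [denotes]
  simp only [hM.val_k, ha, inf_top_eq]
  exact ha.ge

theorem denotes_s (hM : M.IsHAPModel) {a b : Tm langHAP n} {v : Fin n → D}
    (ha : M.denotes a v = ⊤) (hb : M.denotes b v = ⊤) : M.denotes (s ·ₚ a ·ₚ b) v = ⊤ := by
  refine top_le_iff.1 (iSup_elim ha.ge fun x u _ hx => iSup_elim (le_top.trans hb.ge)
    fun y u' hu' hy => ?_)
  have h₀ := hM.basic (.s_den (0 : Fin 2) 1) ![x, y]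
  have h := sem_subst (M := M) (u := u') (σ := ![a, b]) (v := v) (w := ![x, y])
    (fun i => by fin_cases i; exacts [hu'.trans hx, hy]) ((s ·ₚ vr 0 ·ₚ vr 1)↓ₚ)
  rw [h₀, inf_top_eq, Formula.den_subst, sem_den] at h
  simp only [HAP.app_subst, HAP.cst_subst, HAP.vr_subst, Matrix.cons_val_zero,
    Matrix.cons_val_one] at h
  exact inf_eq_left.1 h

theorem denotes_r (hM : M.IsHAPModel) {a b : Tm langHAP n} {v : Fin n → D}
    (ha : M.denotes a v = ⊤) (hb : M.denotes b v = ⊤) : M.denotes (r ·ₚ a ·ₚ b) v = ⊤ := by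
  -- Likewise `r a b` is a subterm of `r a b 0`, whose value is that of `a`.
  refine top_le_iff.1 (le_trans ?_ (denotes_app_left (r ·ₚ a ·ₚ b) zero v))
  rw [denotes]
  simp only [hM.val_r_zero, hb, inf_top_eq]
  exact ha.ge

/-- There is an operation `g` with `g z = e (S z)`. -/
theorem exists_comp_succ (hM : M.IsHAPModel) (e : D) :
    ⨆ g, ⨅ z, ⨅ z', ⨅ w, M.isSucc z z' ⊓ M.isApp e z' w ⇨ M.isApp g z w = ⊤ := by
  -- The witness is `s (k e) succ`, the composition of `e` with successor. Variable 1 is reserved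
  -- for the argument `z`; the term does not contain it, so its value does not depend on `z`.
  have hG : ∀ v : Fin 2 → D, M.denotes (s ·ₚ (k ·ₚ vr 0) ·ₚ sc) v = ⊤ := fun v =>
    hM.denotes_s (hM.denotes_k (denotes_vr _ _)) (denotes_cst _ _)
  have hv : ∀ z, M.val (s ·ₚ (k ·ₚ vr 0) ·ₚ sc) ![e, z] =
      M.val (s ·ₚ (k ·ₚ vr 0) ·ₚ sc) ![e, e] := by
    intro z
    funext g
    simp only [val_app, val_cst, val, Matrix.cons_val_zero]
  refine top_le_iff.1 ((hG ![e, e]).ge.trans (iSup_mono fun g => ?_))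
  refine le_iInf fun z => le_iInf fun z' => le_iInf fun w => le_himp_iff.2 ?_
  rw [← hv z]
  refine isApp_of_val (v := ![e, z]) (t := vr 1) inf_le_left (le_eq_refl _ _) ?_
  rw [hM.val_s, val_app_congr (t := k ·ₚ vr 0 ·ₚ vr 1) (t' := vr 0) (u := sc ·ₚ vr 1)
    (u' := S (vr 1))]
  · refine val_of_isApp (le_eq_refl _ _) ?_ (inf_le_right.trans inf_le_right)
    rw [val_S_vr]
    exact inf_le_right.trans inf_le_left
  · funext z
    rw [hM.val_k, denotes_vr, inf_top_eq]
  · exact hM.val_sc _ _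

/-- There is an operation `e` with `e 0 = a` and `e (S z) = g z`. -/
theorem exists_cases (hM : M.IsHAPModel) (a g : D) :
    M.total g ≤ ⨆ e, (⨅ z, M.isZero z ⇨ M.isApp e z a) ⊓
      ⨅ z, ⨅ z', ⨅ w, M.isSucc z z' ⊓ M.isApp g z w ⇨ M.isApp e z' w := by
  -- The recursor is used for case distinction: its step `s (k k) g` sends `z` and the previous
  -- value to `k (g z)` applied to that value, hence to `g z`.
  let E : Tm langHAP 3 := r ·ₚ vr 0 ·ₚ (s ·ₚ (k ·ₚ k) ·ₚ vr 1)
  have hB : ∀ v, M.denotes (s ·ₚ (k ·ₚ k) ·ₚ vr (1 : Fin 3)) v = ⊤ := fun v =>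
    hM.denotes_s (hM.denotes_k (denotes_cst _ _)) (denotes_vr _ _)
  have hE : ∀ v, M.denotes E v = ⊤ := fun v => hM.denotes_r (denotes_vr _ _) (hB v)
  have hv : ∀ z, M.val E ![a, g, z] = M.val E ![a, g, a] := by
    intro z
    funext g
    simp only [E, val_app, val_cst, val, Matrix.cons_val_zero, Matrix.cons_val_one]
  refine iSup_elim (le_top.trans (hE ![a, g, a]).ge) fun e u hu he => le_iSup_of_le e ?_
  have h₀ : ∀ z, u ⊓ M.isZero z ≤ M.isApp e z a := by
    intro z
    refine isApp_of_val (v := ![a, g, z]) (s := E) (t := zero) ?_ ?_ ?_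
    · rw [hv]; exact inf_le_left.trans he
    · rw [zero, val_cst]; exact inf_le_right
    · rw [hM.val_r_zero, hB, inf_top_eq]; exact le_eq_refl _ _
  have h₁ : ∀ u' ≤ u, ∀ z z' w w', u' ≤ M.isSucc z z' → u' ≤ M.isApp g z w →
      u' ≤ M.isApp e z w' → u' ≤ M.isApp e z' w := by
    intro u' hu' z z' w w' hz hw hw'
    have he' : u' ≤ M.val E ![a, g, z] e := by rw [hv]; exact hu'.trans he
    refine isApp_of_val (v := ![a, g, z]) (s := E) (t := S (vr 2)) he' ?_ ?_
    · rw [val_S_vr]; exact hz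
    · have e₁ : M.val (s ·ₚ (k ·ₚ k) ·ₚ vr 1 ·ₚ vr 2) ![a, g, z] =
          M.val (k ·ₚ (vr 1 ·ₚ vr 2)) ![a, g, z] := by
        rw [hM.val_s]
        refine val_app_congr ?_ rfl
        funext w
        rw [hM.val_k, denotes_vr, inf_top_eq]
      rw [hM.val_r_succ, val_app_congr e₁ rfl, hM.val_k, val_app_vr]
      exact le_inf hw ((val_of_isApp he' (le_eq_refl _ _) hw').trans (val_le_denotes _ _ _))
  -- The step ignores the previous value but is strict in it, so the equation at `S z` is available
  -- only once `e z` denotes. Hence totality of `e` is proved by induction before the equations are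
  -- freed of this proviso.
  have ht : u ≤ M.total e := by
    refine le_iInf fun x => ?_
    refine hM.induction (A := fun v : Fin 2 → D => ⨆ w, M.isApp (v 1) (v 0) w)
      (v := ![e]) ?_ ?_ ?_ x
    · exact .iSup (.isApp _ _ _)
    · exact fun z => le_iSup_of_le a (h₀ z)
    · intro z z'
      have hw : u ⊓ (⨆ w, M.isApp e z w) ⊓ M.isSucc z z' ≤ ⨆ w, M.isApp g z w :=
        (inf_le_left.trans (inf_le_left.trans hu)).trans (iInf_le _ z)
      refine iSup_elim hw fun w u₁ hu₁ hw => ?_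
      refine iSup_elim (hu₁.trans (inf_le_left.trans inf_le_right)) fun w' u₂ hu₂ hw' => ?_
      have hu₂' := hu₂.trans hu₁
      exact le_iSup_of_le w (h₁ u₂ (hu₂'.trans (inf_le_left.trans inf_le_left)) z z' w w'
        (hu₂'.trans inf_le_right) (hu₂.trans hw) hw')
  refine le_inf (le_iInf fun z => le_himp_iff.2 (h₀ z)) ?_
  refine le_iInf fun z => le_iInf fun z' => le_iInf fun w => le_himp_iff.2 ?_
  refine iSup_elim ((inf_le_left.trans ht).trans (iInf_le _ z)) fun w' u' hu' hw' => ?_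
  exact h₁ u' (hu'.trans inf_le_left) z z' w w' (hu'.trans (inf_le_right.trans inf_le_left))
    (hu'.trans (inf_le_right.trans inf_le_right)) hw'

theorem zero_or_succ (hM : M.IsHAPModel) (z : D) : M.isZero z ⊔ ⨆ y, M.isSucc y z = ⊤ := by
  refine top_le_iff.1 (hM.induction (n := 0) (v := ![])
    (A := fun v => M.isZero (v 0) ⊔ ⨆ y, M.isSucc y (v 0)) ?_ ?_ ?_ z)
  · exact .sup (.isZero _) (.iSup (.isSucc _ _))
  · exact fun z => le_sup_of_le_left inf_le_right
  · exact fun x y => le_sup_of_le_right (le_iSup_of_le x inf_le_right)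

/-- A total operation may be updated at one argument. -/
theorem exists_updates (hM : M.IsHAPModel) (e x y : D) :
    total M e ≤ ⨆ e', updates M e x y e' := by
  -- The induction is on the argument `x` where the update takes place; `e` is generalized because
  -- the step applies the hypothesis to the shifted operation `z ↦ e (S z)`.
  suffices h : ∀ x, ⊤ ≤ ⨅ e, ⨅ y, total M e ⇨ ⨆ e', updates M e x y e' by
    have h' := ((h x).trans (iInf_le _ e)).trans (iInf_le _ y)
    exact himp_eq_top_iff.1 (top_le_iff.1 h')
  refine hM.induction (n := 0) (v := ![])
    (A := fun v => ⨅ e, ⨅ y, total M e ⇨ ⨆ e', updates M e (v 0) y e') ?_ ?_ ?_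
  · exact .iInf (.iInf (.himp (.iInf (.iSup (.isApp _ _ _))) (.iSup (.inf (.isApp _ _ _)
      (.iInf (.sup (.eq _ _) (.iSup (.inf (.isApp _ _ _) (.isApp _ _ _)))))))))
  -- At `x = 0` the new operation takes the value `y` at 0 and agrees with the shift `g` of `e` on
  -- successors.
  · refine fun x => le_iInf fun e => le_iInf fun y => le_himp_iff.2 ?_
    refine iSup_elim (le_top.trans (hM.exists_comp_succ e).ge) fun g u hu hg => ?_
    have hu : u ≤ M.isZero x ⊓ total M e := le_inf (hu.trans (inf_le_left.trans inf_le_right))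
      (hu.trans inf_le_right)
    have hg : ∀ u' ≤ u, ∀ z z' w, u' ≤ M.isSucc z z' → u' ≤ M.isApp e z' w →
        u' ≤ M.isApp g z w := fun u' hu' z z' w hz hw =>
      (le_inf (hu'.trans (((hg.trans (iInf_le _ z)).trans (iInf_le _ z')).trans (iInf_le _ w)))
        (le_inf hz hw)).trans himp_inf_le
    have hgt : u ≤ total M g := by
      refine le_iInf fun z => iSup_elim (le_top.trans (hM.isSucc_total z).ge) fun z' u' hu' hz =>
        iSup_elim (hu'.trans (hu.trans (inf_le_right.trans (iInf_le _ z')))) fun w u₂ hu₂ hw => ?_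
      exact le_iSup_of_le w (hg u₂ (hu₂.trans hu') z z' w (hu₂.trans hz) hw)
    refine iSup_elim (hgt.trans (hM.exists_cases y g)) fun e' u' hu' he' => le_iSup_of_le e' ?_
    refine le_inf ?_ (le_iInf fun z => ?_)
    · exact (le_inf (he'.trans (inf_le_left.trans (iInf_le _ x)))
        (hu'.trans (hu.trans inf_le_left))).trans himp_inf_le
    · refine sup_elim (le_top.trans (hM.zero_or_succ z).ge) (fun u₁ hu₁ hz => ?_)
        fun u₁ hu₁ hz => iSup_elim hz fun z₀ u₂ hu₂ hz => ?_
      · exact le_sup_of_le_left ((le_inf hz (hu₁.trans (hu'.trans (hu.trans inf_le_left)))).trans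
          (M.fn_unique _ _ _ _))
      · have hu₂' := (hu₂.trans hu₁).trans hu'
        refine iSup_elim (hu₂'.trans (hu.trans (inf_le_right.trans (iInf_le _ z))))
          fun w u₃ hu₃ hw => le_sup_of_le_right (le_iSup_of_le w (le_inf hw ?_))
        have h := hu₃.trans ((hu₂.trans hu₁).trans (he'.trans inf_le_right))
        exact (le_inf (((h.trans (iInf_le _ z₀)).trans (iInf_le _ z)).trans (iInf_le _ w))
          (le_inf (hu₃.trans hz) (hg u₃ (hu₃.trans hu₂') z₀ z w (hu₃.trans hz) hw))).trans
          himp_inf_le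
  -- At `x' = S x`, let `g` be the shift of `e` and `g'` its update at `x`. The new operation takes
  -- the value `a = e 0` at 0 and `g' z` at `S z`.
  · refine fun x x' => le_iInf fun e => le_iInf fun y => le_himp_iff.2 ?_
    refine iSup_elim (le_top.trans (hM.exists_comp_succ e).ge) fun g u hu hg => ?_
    have hx : u ≤ M.isSucc x x' := hu.trans (inf_le_left.trans inf_le_right)
    have he : u ≤ total M e := hu.trans inf_le_right
    have ih : u ≤ total M g ⇨ ⨆ e', updates M g x y e' :=
      (hu.trans (inf_le_left.trans (inf_le_left.trans inf_le_right))).trans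
        ((iInf_le _ g).trans (iInf_le _ y))
    have hg : ∀ u' ≤ u, ∀ z z' w, u' ≤ M.isSucc z z' → u' ≤ M.isApp e z' w →
        u' ≤ M.isApp g z w := fun u' hu' z z' w hz hw =>
      (le_inf (hu'.trans (((hg.trans (iInf_le _ z)).trans (iInf_le _ z')).trans (iInf_le _ w)))
        (le_inf hz hw)).trans himp_inf_le
    have hgt : u ≤ total M g := by
      refine le_iInf fun z => iSup_elim (le_top.trans (hM.isSucc_total z).ge) fun z' u' hu' hz =>
        iSup_elim (hu'.trans (he.trans (iInf_le _ z'))) fun w u₂ hu₂ hw => ?_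
      exact le_iSup_of_le w (hg u₂ (hu₂.trans hu') z z' w (hu₂.trans hz) hw)
    refine iSup_elim ((le_inf ih hgt).trans himp_inf_le) fun g' u₁ hu₁ hg' => ?_
    refine iSup_elim (le_top.trans (M.const_total (L := langHAP) HAPFunc.zero ![]).ge)
      fun z₀ u₂ hu₂ hz₀ => ?_
    have hz₀ : u₂ ≤ M.isZero z₀ := hz₀
    refine iSup_elim ((hu₂.trans hu₁).trans (he.trans (iInf_le _ z₀))) fun a u₃ hu₃ ha => ?_
    refine iSup_elim ((hu₃.trans hu₂).trans
      ((total_of_updates hg').trans (hM.exists_cases a g'))) fun e' u₄ hu₄ he' => ?_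
    have he'₁ : ∀ u' ≤ u₄, ∀ z, u' ≤ M.isZero z → u' ≤ M.isApp e' z a := fun u' hu' z hz =>
      (le_inf (hu'.trans (he'.trans (inf_le_left.trans (iInf_le _ z)))) hz).trans himp_inf_le
    have he'₂ : ∀ u' ≤ u₄, ∀ z z' w, u' ≤ M.isSucc z z' → u' ≤ M.isApp g' z w →
        u' ≤ M.isApp e' z' w := fun u' hu' z z' w hz hw =>
      (le_inf (hu'.trans ((((he'.trans inf_le_right).trans (iInf_le _ z)).trans
        (iInf_le _ z')).trans (iInf_le _ w))) (le_inf hz hw)).trans himp_inf_le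
    have h₄₂ := hu₄.trans hu₃
    have h₄₁ := h₄₂.trans hu₂
    have h₄ := h₄₁.trans hu₁
    refine le_iSup_of_le e' (le_inf ?_ (le_iInf fun z => ?_))
    · exact he'₂ u₄ le_rfl x x' y (h₄.trans hx) (h₄₁.trans (hg'.trans inf_le_left))
    · refine sup_elim (le_top.trans (hM.zero_or_succ z).ge) (fun u₅ hu₅ hz => ?_)
        fun u₅ hu₅ hz => iSup_elim hz fun y₀ u₆ hu₆ hz => ?_
      · refine le_sup_of_le_right (le_iSup_of_le a (le_inf ?_ (he'₁ u₅ hu₅ z hz)))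
        refine isApp_congr (le_eq_refl _ _) ?_ (le_eq_refl _ _) ((hu₅.trans hu₄).trans ha)
        exact (le_inf (hu₅.trans (h₄₂.trans hz₀)) hz).trans (M.fn_unique _ _ _ _)
      · have h₆ := hu₆.trans hu₅
        refine sup_elim ((h₆.trans h₄₁).trans (hg'.trans (inf_le_right.trans (iInf_le _ y₀))))
          (fun u₇ hu₇ hy => ?_) (fun u₇ hu₇ hy => ?_)
        · refine le_sup_of_le_left (isSucc_unique (hu₇.trans hz) ?_)
          exact isSucc_congr (le_eq_symm hy) (le_eq_refl _ _) ((hu₇.trans (h₆.trans h₄)).trans hx)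
        · refine iSup_elim ((hu₇.trans (h₆.trans h₄)).trans (he.trans (iInf_le _ z)))
            fun w u₈ hu₈ hw => iSup_elim (hu₈.trans hy) fun w' u₉ hu₉ hy => ?_
          have h₉ := hu₉.trans (hu₈.trans hu₇)
          refine le_sup_of_le_right (le_iSup_of_le w (le_inf (hu₉.trans hw) ?_))
          refine he'₂ u₉ (h₉.trans h₆) y₀ z w (h₉.trans hz) ?_
          refine isApp_congr (le_eq_refl _ _) (le_eq_refl _ _) ?_ (hy.trans inf_le_right)
          exact isApp_unique (hy.trans inf_le_left)
            (hg u₉ (h₉.trans (h₆.trans h₄)) y₀ z w (h₉.trans hz) (hu₉.trans hw))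

end IsHAPModel

end HAPModel

end LPT.FrameModel

namespace LPT.FrameModel

open FirstOrder.Language (Term)

universe w x

/-- The identity substitution turns `sem_subst` into invariance of formulas under equality of the
parameters. -/
theorem sem_congr {L : FirstOrder.Language} [L.IsAlgebraic] {H : Type w} [Order.Frame H]
    {D : Type x} {M : FrameModel L H D} {n : ℕ} {u : H} {v v' : Fin n → D}
    (h : ∀ i, u ≤ M.eq (v i) (v' i)) (φ : Formula L n) (h' : u ≤ M.sem φ v) : u ≤ M.sem φ v' := by
  have := sem_subst (M := M) (σ := vr) h φ
  rw [Formula.subst_vr] at this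
  exact ((le_inf le_rfl h').trans this.le).trans inf_le_right

/-! ### Forcing conditions -/

section Forcing

variable {H : Type w} [Order.Frame H] {D : Type x} (M : FrameModel langHAP H D)
  (ψ : Formula langHAP 2)

/-- The truth value of `p x = S y`: the condition `p` forces that `f(x) = y`. -/
def mapsTo (p x y : D) : H := ⨆ s, M.isSucc y s ⊓ M.isApp p x s

/-- The truth value of: `p` is a condition, that is, `p` is a total operation, where `p x = 0` means
that `p` gives no information on `f(x)`, and `p x = S y` only if `ψ(x, y)`. -/
def cond (p : D) : H :=
  ⨅ x, ((⨆ z, M.isZero z ⊓ M.isApp p x z) ⊔ ⨆ y, M.mapsTo p x y ⊓ M.sem ψ ![x, y])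

/-- The truth value of: `q` is a condition that refines the condition `p`. -/
def refines (p q : D) : H :=
  M.cond ψ p ⊓ M.cond ψ q ⊓ ⨅ x, ⨅ y, M.mapsTo p x y ⇨ M.mapsTo q x y

variable {M ψ}

theorem refines_le_left (p q : D) : M.refines ψ p q ≤ M.cond ψ p := inf_le_left.trans inf_le_left

theorem refines_le_right (p q : D) : M.refines ψ p q ≤ M.cond ψ q :=
  inf_le_left.trans inf_le_right

theorem refines_refl {u : H} {p : D} (h : u ≤ M.cond ψ p) : u ≤ M.refines ψ p p :=
  le_inf (le_inf h h) (le_iInf fun _ => le_iInf fun _ => le_himp_iff.2 inf_le_right)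

theorem mapsTo_of_refines {u : H} {p q x y : D} (h : u ≤ M.refines ψ p q)
    (h' : u ≤ M.mapsTo p x y) : u ≤ M.mapsTo q x y :=
  (le_inf (h.trans (inf_le_right.trans ((iInf_le _ x).trans (iInf_le _ y)))) h').trans himp_inf_le

theorem refines_trans {u : H} {p q r : D} (h : u ≤ M.refines ψ p q) (h' : u ≤ M.refines ψ q r) :
    u ≤ M.refines ψ p r := by
  refine le_inf (le_inf (h.trans (refines_le_left _ _)) (h'.trans (refines_le_right _ _))) ?_
  refine le_iInf fun x => le_iInf fun y => le_himp_iff.2 ?_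
  exact mapsTo_of_refines (inf_le_left.trans h') (mapsTo_of_refines (inf_le_left.trans h)
    inf_le_right)

theorem mapsTo_congr {u : H} {p x y x' y' : D} (hx : u ≤ M.eq x x') (hy : u ≤ M.eq y y')
    (h : u ≤ M.mapsTo p x y) : u ≤ M.mapsTo p x' y' :=
  iSup_elim h fun s _ hu hs => le_iSup_of_le s (le_inf
    (isSucc_congr (hu.trans hy) (le_eq_refl _ _) (hs.trans inf_le_left))
    (isApp_congr (le_eq_refl _ _) (hu.trans hx) (le_eq_refl _ _) (hs.trans inf_le_right)))

namespace Definable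

variable {n : ℕ}

theorem mapsTo (i j l : Fin n) : M.Definable fun v => M.mapsTo (v i) (v j) (v l) :=
  .iSup (.inf (.isSucc _ _) (.isApp _ _ _))

theorem cond (i : Fin n) : M.Definable fun v => M.cond ψ (v i) := by
  refine .iInf (.sup (.iSup (.inf (.isZero _) (.isApp _ _ _))) (.iSup (.inf (.mapsTo _ _ _) ?_)))
  convert (Definable.sem (M := M) ψ).rename ![(1 : Fin (n + 2)), 0] using 3 with v
  funext i
  fin_cases i <;> rfl

theorem refines (i j : Fin n) : M.Definable fun v => M.refines ψ (v i) (v j) :=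
  .inf (.inf (.cond _) (.cond _)) (.iInf (.iInf (.himp (.mapsTo _ _ _) (.mapsTo _ _ _))))

end Definable

namespace IsHAPModel

theorem mapsTo_unique (hM : M.IsHAPModel) {u : H} {p x y z : D} (h : u ≤ M.mapsTo p x y)
    (h' : u ≤ M.mapsTo p x z) : u ≤ M.eq y z :=
  iSup_elim h fun _ _ hu hs => iSup_elim (hu.trans h') fun _ _ hu' ht =>
    hM.isSucc_injective (hu'.trans (hs.trans inf_le_left)) (isSucc_congr (le_eq_refl _ _)
      (isApp_unique (ht.trans inf_le_right) (hu'.trans (hs.trans inf_le_right)))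
      (ht.trans inf_le_left))

theorem mapsTo_zero (hM : M.IsHAPModel) {u : H} {p x y z : D} (h : u ≤ M.mapsTo p x y)
    (h' : u ≤ M.isZero z ⊓ M.isApp p x z) : u ≤ ⊥ :=
  iSup_elim h fun _ _ hu hs => hM.isZero_isSucc (hu.trans (h'.trans inf_le_left))
    (isSucc_congr (le_eq_refl _ _)
      (isApp_unique (hs.trans inf_le_right) (hu.trans (h'.trans inf_le_right)))
      (hs.trans inf_le_left))

/-- A condition forces only correct values. -/
theorem sem_of_mapsTo (hM : M.IsHAPModel) {u : H} {p x y : D} (hp : u ≤ M.cond ψ p)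
    (h : u ≤ M.mapsTo p x y) : u ≤ M.sem ψ ![x, y] := by
  refine sup_elim (hp.trans (iInf_le _ x)) (fun u' hu hz => ?_) (fun u' hu hy => ?_)
  · exact iSup_elim hz fun z u'' hu' hz => (hM.mapsTo_zero ((hu'.trans hu).trans h) hz).trans bot_le
  · refine iSup_elim hy fun y' u'' hu' hy => sem_congr (v := ![x, y']) (fun i => ?_) ψ
      (hy.trans inf_le_right)
    fin_cases i
    · exact le_eq_refl _ _
    · exact hM.mapsTo_unique (hy.trans inf_le_left) ((hu'.trans hu).trans h)

theorem total_of_cond {u : H} {p : D} (hp : u ≤ M.cond ψ p) : u ≤ M.total p := by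
  refine le_iInf fun x => sup_elim (hp.trans (iInf_le _ x)) (fun u' hu hz => ?_)
    (fun u' hu hy => ?_)
  · exact hz.trans (iSup_mono fun z => inf_le_right)
  · exact iSup_elim hy fun y u'' hu' hy => (hy.trans inf_le_left).trans
      (iSup_mono fun s => inf_le_right)

/-- A condition may be refined so as to give a value where it gives no information. -/
theorem exists_refines_of_isZero (hM : M.IsHAPModel) {u : H} {p x y z : D}
    (hp : u ≤ M.cond ψ p) (hz : u ≤ M.isZero z ⊓ M.isApp p x z) (hy : u ≤ M.sem ψ ![x, y]) :
    u ≤ ⨆ q, M.refines ψ p q ⊓ M.mapsTo q x y := by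
  refine iSup_elim (le_top.trans (hM.isSucc_total y).ge) fun s u₁ hu₁ hs => ?_
  -- Here `s` is the value of `S y`, and `q` is `p` changed to `s` at `x`.
  refine iSup_elim (hu₁.trans ((total_of_cond hp).trans (hM.exists_updates p x s)))
    fun q u₂ hu₂ hq => le_iSup_of_le q ?_
  have hs := hu₂.trans hs
  have hu := hu₂.trans hu₁
  have hqx : u₂ ≤ M.mapsTo q x y := le_iSup_of_le s (le_inf hs (hq.trans inf_le_left))
  have hqz : ∀ x', u₂ ≤ M.eq x' x ⊔ ⨆ w, M.isApp p x' w ⊓ M.isApp q x' w := fun x' =>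
    hq.trans (inf_le_right.trans (iInf_le _ x'))
  refine le_inf (le_inf (le_inf (hu.trans hp) (le_iInf fun x' => ?_))
    (le_iInf fun x' => le_iInf fun y' => le_himp_iff.2 ?_)) hqx
  · refine sup_elim (hqz x') (fun u₃ hu₃ hx => ?_) fun u₃ hu₃ hw => iSup_elim hw
      fun w u₄ hu₄ hw => ?_
    · refine le_sup_of_le_right (le_iSup_of_le y (le_inf
        (mapsTo_congr (le_eq_symm hx) (le_eq_refl _ _) (hu₃.trans hqx)) ?_))
      refine sem_congr (v := ![x, y]) (fun i => ?_) ψ ((hu₃.trans hu).trans hy)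
      fin_cases i
      exacts [le_eq_symm hx, le_eq_refl _ _]
    · have hqw := hw.trans inf_le_right
      refine sup_elim (((hu₄.trans hu₃).trans hu).trans (hp.trans (iInf_le _ x')))
        (fun u₅ hu₅ h => le_sup_of_le_left (iSup_elim h fun z' u₆ hu₆ hz' => ?_))
        (fun u₅ hu₅ h => le_sup_of_le_right (iSup_elim h fun y' u₆ hu₆ hy' => ?_))
      · refine le_iSup_of_le z' (le_inf (hz'.trans inf_le_left) (isApp_congr (le_eq_refl _ _)
          (le_eq_refl _ _) ?_ ((hu₆.trans hu₅).trans hqw)))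
        exact isApp_unique ((hu₆.trans hu₅).trans (hw.trans inf_le_left)) (hz'.trans inf_le_right)
      · refine le_iSup_of_le y' (le_inf ?_ (hy'.trans inf_le_right))
        refine iSup_elim (hy'.trans inf_le_left) fun s' u₇ hu₇ hs' => ?_
        have h₇ := hu₇.trans (hu₆.trans hu₅)
        refine le_iSup_of_le s' (le_inf (hs'.trans inf_le_left) (isApp_congr (le_eq_refl _ _)
          (le_eq_refl _ _) ?_ (h₇.trans hqw)))
        exact isApp_unique (h₇.trans (hw.trans inf_le_left)) (hs'.trans inf_le_right)
  · refine sup_elim (inf_le_left.trans (hqz x')) (fun u₃ hu₃ hx => ?_) fun u₃ hu₃ hw =>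
      iSup_elim hw fun w u₄ hu₄ hw => ?_
    -- If `x' = x`, an old value of `p` there would contradict `p x = 0`; so the update overwrites
    -- no information.
    · refine (hM.mapsTo_zero (p := p) (x := x) (y := y') ?_
        ((hu₃.trans inf_le_left).trans (hu.trans hz))).trans bot_le
      exact mapsTo_congr hx (le_eq_refl _ _) (hu₃.trans inf_le_right)
    · refine iSup_elim (hu₄.trans (hu₃.trans inf_le_right)) fun s' u₅ hu₅ hs' => ?_
      refine le_iSup_of_le s' (le_inf (hs'.trans inf_le_left) (isApp_congr (le_eq_refl _ _)
          (le_eq_refl _ _) ?_ (hu₅.trans (hw.trans inf_le_right))))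
      exact isApp_unique (hu₅.trans (hw.trans inf_le_left)) (hs'.trans inf_le_right)

/-- There is a condition. -/
theorem iSup_cond (hM : M.IsHAPModel) : ⨆ p, M.cond ψ p = ⊤ := by
  refine top_le_iff.1 (iSup_elim (M.const_total (L := langHAP) HAPFunc.zero ![]).ge
    fun z u _ hz => ?_)
  have hz : u ≤ M.isZero z := hz
  -- The condition is `k 0`, the operation constantly 0, which gives no information at all.
  have hv : ∀ x, M.val (HAP.k ·ₚ HAP.zero) ![x] = M.val (HAP.k ·ₚ HAP.zero) ![z] := by
    intro x
    funext p
    simp only [val_app, val_cst, HAP.k, HAP.zero]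
  have hk : M.denotes (HAP.k ·ₚ HAP.zero) ![z] = ⊤ := hM.denotes_k (denotes_cst _ _)
  refine iSup_elim (le_top.trans hk.ge) fun p u' hu hp => le_iSup_of_le p (le_iInf fun x =>
    le_sup_of_le_left (le_iSup_of_le z (le_inf (hu.trans hz) ?_)))
  refine isApp_of_val (v := ![x]) (t := vr 0) (by rwa [hv]) (le_eq_refl _ _) ?_
  rw [hM.val_k, denotes_vr, inf_top_eq, val_cst]
  exact hu.trans hz

end IsHAPModel

end Forcing

end LPT.FrameModel

namespace LPT.FrameModel

open FirstOrder.Language (Term)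

universe w x

variable {H : Type w} [Order.Frame H] {D : Type x} (M : FrameModel langHAP H D)
  (ψ : Formula langHAP 2)

/-! ### The frame of forcing -/

/-- A partial forcing condition: an element together with a truth value below that of its being a
condition. -/
structure Condition where
  truth : H
  elt : D
  le_cond : truth ≤ M.cond ψ elt

variable {M ψ}

namespace Condition

/-- Smaller means stronger: `b` may shrink the truth value as well as refine the operation, and the
refinement has to hold only as far as `b.truth`. -/
instance : Preorder (M.Condition ψ) where
  le b a := b.truth ≤ a.truth ∧ b.truth ≤ M.refines ψ a.elt b.elt
  le_refl a := ⟨le_rfl, refines_refl a.le_cond⟩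
  le_trans _ _ _ h h' := ⟨h.1.trans h'.1, refines_trans (h.1.trans h'.2) h.2⟩

theorem le_def {a b : M.Condition ψ} :
    b ≤ a ↔ b.truth ≤ a.truth ∧ b.truth ≤ M.refines ψ a.elt b.elt := Iff.rfl

/-- Shrinking the truth value of a condition. -/
def restrict (a : M.Condition ψ) (h : H) : M.Condition ψ :=
  ⟨a.truth ⊓ h, a.elt, inf_le_left.trans a.le_cond⟩

theorem restrict_le (a : M.Condition ψ) (h : H) : a.restrict h ≤ a :=
  ⟨inf_le_left, refines_refl (inf_le_left.trans a.le_cond)⟩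

theorem mk_le_mk {p : D} {g h : H} {hg : g ≤ M.cond ψ p} {hh : h ≤ M.cond ψ p} (hgh : g ≤ h) :
    (⟨g, p, hg⟩ : M.Condition ψ) ≤ ⟨h, p, hh⟩ := ⟨hgh, refines_refl hg⟩

end Condition

variable (M ψ) in
/-- The nucleus of dense coverings. -/
def forcing : Nucleus (LowerSet (M.Condition ψ)) where
  -- Density below `a`, read inside `M`: each `b ≤ a` is exhausted, in truth value, by members of
  -- `U` below it. No single refinement need work for all of `b`.
  toFun U := ⟨{a | ∀ b ≤ a, b.truth ≤ ⨆ c : M.Condition ψ, ⨆ _ : c ∈ U ∧ c ≤ b, c.truth},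
    fun _ _ hba ha d hd => ha d (hd.trans hba)⟩
  map_inf' U V := by
    refine le_antisymm (le_inf ?_ ?_) ?_
    · exact fun a ha b hb => (ha b hb).trans
        (iSup_mono fun c => iSup_mono' fun hc => ⟨⟨hc.1.1, hc.2⟩, le_rfl⟩)
    · exact fun a ha b hb => (ha b hb).trans
        (iSup_mono fun c => iSup_mono' fun hc => ⟨⟨hc.1.2, hc.2⟩, le_rfl⟩)
    · refine fun a ha b hb => (ha.1 b hb).trans (iSup₂_le fun c hc => ?_)
      refine (ha.2 c (hc.2.trans hb)).trans (iSup₂_le fun d hd => ?_)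
      exact le_iSup₂_of_le d ⟨⟨U.lower hd.2 hc.1, hd.1⟩, hd.2.trans hc.2⟩ le_rfl
  idempotent' U a ha b hb := by
    refine (ha b hb).trans (iSup₂_le fun c hc => (hc.1 c le_rfl).trans (iSup₂_le fun d hd => ?_))
    exact le_iSup₂_of_le d ⟨hd.1, hd.2.trans hc.2⟩ le_rfl
  le_apply' U a ha b hb := le_iSup₂_of_le b ⟨U.lower hb ha, le_rfl⟩ le_rfl

theorem mem_forcing {U : LowerSet (M.Condition ψ)} {a : M.Condition ψ} :
    a ∈ M.forcing ψ U ↔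
      ∀ b ≤ a, b.truth ≤ ⨆ c : M.Condition ψ, ⨆ _ : c ∈ U ∧ c ≤ b, c.truth := Iff.rfl

variable (M ψ) in
/-- The truth values of forcing. -/
abbrev Forced : Type (max w x) := (M.forcing ψ).toSublocale

theorem mem_forced_iff {A : M.Forced ψ} {a : M.Condition ψ} :
    a ∈ A.1 ↔ ∀ b ≤ a, b.truth ≤ ⨆ c : M.Condition ψ, ⨆ _ : c ∈ A.1 ∧ c ≤ b, c.truth := by
  rw [← mem_forcing, Nucleus.closure_val]

variable (ψ) in
/-- The truth value of a statement that does not depend on the condition. -/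
def const (h : H) : M.Forced ψ := by
  refine ⟨⟨{a | a.truth ≤ h}, fun _ _ hba ha => hba.1.trans ha⟩, _, le_antisymm (fun a ha => ?_)
    (Nucleus.le_apply)⟩
  exact (ha a le_rfl).trans (iSup₂_le fun c hc => hc.1)

theorem mem_const {h : H} {a : M.Condition ψ} : a ∈ (const ψ h).1 ↔ a.truth ≤ h := Iff.rfl

theorem const_mono {g h : H} (hgh : g ≤ h) : const (M := M) ψ g ≤ const ψ h :=
  fun _ ha => le_trans ha hgh

theorem const_top : const (M := M) ψ ⊤ = ⊤ := top_le_iff.1 fun a _ => (le_top : a.truth ≤ ⊤)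

theorem const_bot : const (M := M) ψ ⊥ = ⊥ := by
  refine le_bot_iff.1 fun a ha => Nucleus.mem_bot.2 (mem_forcing.2 fun b hb => ?_)
  exact (hb.1.trans ha).trans bot_le

theorem const_inf (g h : H) : const (M := M) ψ (g ⊓ h) = const ψ g ⊓ const ψ h :=
  Nucleus.frame_ext fun _ => le_inf_iff

theorem const_iInf {ι : Sort*} (h : ι → H) :
    const (M := M) ψ (⨅ i, h i) = ⨅ i, const ψ (h i) :=
  Nucleus.frame_ext fun _ => by
    simp only [Nucleus.mem_iInf, mem_const, le_iInf_iff]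

/-- A condition can be restricted to the truth value `g` without touching its operation, so one
restriction tests the implication. The same freedom makes `const` commute with joins. -/
theorem const_himp (g h : H) : const (M := M) ψ (g ⇨ h) = const ψ g ⇨ const ψ h := by
  refine Nucleus.frame_ext fun a => ?_
  rw [Nucleus.mem_himp]
  refine ⟨fun ha b hb hg => (le_inf (hb.1.trans ha) hg).trans himp_inf_le, fun ha => ?_⟩
  exact le_himp_iff.2 (ha (a.restrict g) (a.restrict_le g) inf_le_right)

theorem const_iSup {ι : Sort*} (h : ι → H) :
    const (M := M) ψ (⨆ i, h i) = ⨆ i, const ψ (h i) := by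
  refine le_antisymm (fun a ha => Nucleus.mem_iSup.2 (mem_forcing.2 fun b hb => ?_))
    (iSup_le fun i => const_mono (le_iSup h i))
  refine le_of_le_iSup (hb.1.trans ha) fun i => ?_
  exact le_iSup₂_of_le (b.restrict (h i))
    ⟨LowerSet.mem_iSup_iff.2 ⟨i, mem_const.2 inf_le_right⟩, b.restrict_le _⟩ le_rfl

theorem const_sup (g h : H) : const (M := M) ψ (g ⊔ h) = const ψ g ⊔ const ψ h := by
  simp only [sup_eq_iSup, const_iSup]
  exact iSup_congr fun b => by cases b <;> rfl

/-- The truth value of: the condition `p` belongs to `U`. -/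
def fiber (U : LowerSet (M.Condition ψ)) (p : D) : H :=
  ⨆ h : H, ⨆ _ : ∃ hp : h ≤ M.cond ψ p, (⟨h, p, hp⟩ : M.Condition ψ) ∈ U, h

theorem le_fiber {U : LowerSet (M.Condition ψ)} {a : M.Condition ψ} (h : a ∈ U) :
    a.truth ≤ fiber U a.elt := le_iSup₂_of_le a.truth ⟨a.le_cond, h⟩ le_rfl

/-- In a closed set, members with the same operation glue along joins of their truth values. A
closed set is therefore determined by a map from elements of `M` to truth values of `M`, a form in
which its definability by a formula of HAP makes sense. -/
theorem mem_iff_le_fiber {A : M.Forced ψ} {a : M.Condition ψ} :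
    a ∈ A.1 ↔ a.truth ≤ fiber A.1 a.elt := by
  refine ⟨le_fiber, fun h => mem_forced_iff.2 fun b hb => ?_⟩
  refine le_of_le_iSup (hb.1.trans h) fun g => le_of_le_iSup inf_le_right fun hg => ?_
  obtain ⟨hp, hg⟩ := hg
  refine le_iSup₂_of_le (b.restrict g) ⟨A.1.lower ?_ hg, b.restrict_le g⟩
    (inf_le_inf_right _ inf_le_left |>.trans (by rw [Condition.restrict]))
  exact ⟨inf_le_right, inf_le_left.trans hb.2⟩

theorem fiber_le_cond (U : LowerSet (M.Condition ψ)) (p : D) : fiber U p ≤ M.cond ψ p :=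
  iSup₂_le fun _ h => h.1

theorem fiber_eq {U : LowerSet (M.Condition ψ)} {p : D} {B : H}
    (h : ∀ u, ∀ hu : u ≤ M.cond ψ p, (⟨u, p, hu⟩ : M.Condition ψ) ∈ U ↔ u ≤ B) :
    fiber U p = M.cond ψ p ⊓ B := by
  refine le_antisymm (iSup₂_le fun u hu => le_inf hu.1 ((h u _).1 hu.2)) ?_
  exact le_iSup₂_of_le _ ⟨inf_le_left, (h _ _).2 inf_le_right⟩ le_rfl

theorem fiber_const (h : H) (p : D) : fiber (const (M := M) ψ h).1 p = M.cond ψ p ⊓ h :=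
  fiber_eq fun _ _ => Iff.rfl

theorem fiber_inf (A B : M.Forced ψ) (p : D) :
    fiber (A ⊓ B).1 p = M.cond ψ p ⊓ (fiber A.1 p ⊓ fiber B.1 p) :=
  fiber_eq fun u hu => by
    rw [Nucleus.mem_inf, mem_iff_le_fiber, mem_iff_le_fiber, le_inf_iff]

theorem fiber_iInf {ι : Sort*} (A : ι → M.Forced ψ) (p : D) :
    fiber (⨅ i, A i).1 p = M.cond ψ p ⊓ ⨅ i, fiber (A i).1 p :=
  fiber_eq fun u hu => by
    simp only [Nucleus.mem_iInf, mem_iff_le_fiber, le_iInf_iff]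

/-- The forcing clause for implication: quantification over refinements takes place inside `M`, so
the clause is itself expressible in HAP. -/
theorem fiber_himp (A B : M.Forced ψ) (p : D) :
    fiber (A ⇨ B).1 p =
      M.cond ψ p ⊓ ⨅ q, M.refines ψ p q ⊓ fiber A.1 q ⇨ fiber B.1 q := by
  refine fiber_eq fun u hu => ?_
  rw [Nucleus.mem_himp]
  refine ⟨fun h => le_iInf fun q => le_himp_iff.2 ?_, fun h b hb hA => ?_⟩
  · let b : M.Condition ψ := ⟨u ⊓ (M.refines ψ p q ⊓ fiber A.1 q), q,
      inf_le_right.trans (inf_le_right.trans (fiber_le_cond _ _))⟩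
    exact mem_iff_le_fiber.1 (h b ⟨inf_le_left, inf_le_right.trans inf_le_left⟩
      (mem_iff_le_fiber.2 (inf_le_right.trans inf_le_right)))
  · exact mem_iff_le_fiber.2 ((le_inf (hb.1.trans (h.trans (iInf_le _ b.elt)))
      (le_inf hb.2 (mem_iff_le_fiber.1 hA))).trans himp_inf_le)

/-- Membership in a closure becomes the internal statement that each refinement `q` of `p` has a
further refinement `r` in `U`. This clause serves disjunction, existence and equations `f(x) = y`.
-/
theorem fiber_close (U : LowerSet (M.Condition ψ)) (p : D) :
    fiber ((M.forcing ψ).close U).1 p =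
      M.cond ψ p ⊓ ⨅ q, M.refines ψ p q ⇨ ⨆ r, M.refines ψ q r ⊓ fiber U r := by
  refine fiber_eq fun u hu => ?_
  refine ⟨fun h => le_iInf fun q => le_himp_iff.2 ?_, fun h b hb => ?_⟩
  · let b : M.Condition ψ := ⟨u ⊓ M.refines ψ p q, q, inf_le_right.trans (refines_le_right _ _)⟩
    refine (h b ⟨inf_le_left, inf_le_right⟩).trans (iSup₂_le fun c hc => ?_)
    exact le_iSup_of_le c.elt (le_inf hc.2.2 (le_fiber hc.1))
  · refine iSup_elim ((le_inf (hb.1.trans (h.trans (iInf_le _ b.elt))) hb.2).trans himp_inf_le)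
      fun r u₁ hu₁ hr => iSup_elim (hr.trans inf_le_right) fun g u₂ hu₂ hg => ?_
    refine iSup_elim hg fun hg' u₃ hu₃ hg => ?_
    obtain ⟨hp, hgU⟩ := hg'
    have h₃ := hu₃.trans hu₂
    exact le_iSup₂_of_le (⟨u₃, r, hg.trans hp⟩ : M.Condition ψ) ⟨U.lower (Condition.mk_le_mk hg) hgU,
      ⟨h₃.trans hu₁, h₃.trans (hr.trans inf_le_left)⟩⟩ le_rfl

theorem fiber_iSup_lowerSet {ι : Sort*} (U : ι → LowerSet (M.Condition ψ)) (p : D) :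
    fiber (⨆ i, U i) p = ⨆ i, fiber (U i) p := by
  refine le_antisymm (iSup₂_le fun h hh => ?_) (iSup_le fun i => iSup₂_le fun h hh => ?_)
  · obtain ⟨hp, hU⟩ := hh
    obtain ⟨i, hi⟩ := LowerSet.mem_iSup_iff.1 hU
    exact le_iSup_of_le i (le_iSup₂_of_le h ⟨hp, hi⟩ le_rfl)
  · exact le_iSup₂_of_le h ⟨hh.1, LowerSet.mem_iSup_iff.2 ⟨i, hh.2⟩⟩ le_rfl

theorem fiber_iSup {ι : Sort*} (A : ι → M.Forced ψ) (p : D) :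
    fiber (⨆ i, A i).1 p =
      M.cond ψ p ⊓ ⨅ q, M.refines ψ p q ⇨ ⨆ r, M.refines ψ q r ⊓ ⨆ i, fiber (A i).1 r := by
  rw [Nucleus.iSup_eq_close, fiber_close]
  simp only [fiber_iSup_lowerSet]

/-! ### Definability of forcing -/

/-- A predicate is definably forced if the relation of forcing it is definable. -/
def DefinablyForced {n : ℕ} (A : (Fin n → D) → M.Forced ψ) : Prop :=
  M.Definable fun v : Fin (n + 1) → D => fiber (A fun i => v i.succ).1 (v 0)

namespace DefinablyForced

variable {n m : ℕ} {A B : (Fin n → D) → M.Forced ψ}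

theorem const {A : (Fin n → D) → H} (hA : M.Definable A) :
    DefinablyForced fun v => FrameModel.const (M := M) ψ (A v) := by
  simp only [DefinablyForced, fiber_const]
  exact .inf (.cond _) (hA.rename Fin.succ)

theorem rename (hA : DefinablyForced A) (ρ : Fin n → Fin m) :
    DefinablyForced fun v => A fun i => v (ρ i) := by
  exact Definable.rename hA (Fin.cons 0 fun i => (ρ i).succ : Fin (n + 1) → Fin (m + 1))

theorem inf (hA : DefinablyForced A) (hB : DefinablyForced B) :
    DefinablyForced fun v => A v ⊓ B v := by
  simp only [DefinablyForced, fiber_inf]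
  exact .inf (.cond _) (.inf hA hB)

theorem himp (hA : DefinablyForced A) (hB : DefinablyForced B) :
    DefinablyForced fun v => A v ⇨ B v := by
  simp only [DefinablyForced, fiber_himp]
  -- Index 0 is the quantified refinement `q` and index 1 the original condition `p`; the condition
  -- slot of `A` and `B` goes to `q`.
  let ρ : Fin (n + 1) → Fin (n + 2) := Fin.cons 0 fun i => i.succ.succ
  exact .inf (.cond _) (.iInf (.himp (.inf (.refines _ _) (Definable.rename hA ρ))
    (Definable.rename hB ρ)))

theorem iInf {A : D → (Fin n → D) → M.Forced ψ}
    (h : DefinablyForced fun v : Fin (n + 1) → D => A (v 0) fun i => v i.succ) :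
    DefinablyForced fun v => ⨅ x, A x v := by
  simp only [DefinablyForced, fiber_iInf]
  let ρ : Fin (n + 2) → Fin (n + 2) := Fin.cons 1 (Fin.cons 0 fun i => i.succ.succ)
  exact .inf (.cond _) (.iInf (Definable.rename h ρ))

theorem iSup {A : D → (Fin n → D) → M.Forced ψ}
    (h : DefinablyForced fun v : Fin (n + 1) → D => A (v 0) fun i => v i.succ) :
    DefinablyForced fun v => ⨆ x, A x v := by
  simp only [DefinablyForced, fiber_iSup]
  -- Under the three quantifiers, indices 0 to 3 hold `x`, `r`, `q`, `p`; the condition slot of `A`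
  -- goes to `r`.
  let ρ : Fin (n + 2) → Fin (n + 4) :=
    Fin.cons 1 (Fin.cons 0 fun i => i.succ.succ.succ.succ)
  exact .inf (.cond _) (.iInf (.himp (.refines _ _) (.iSup (.inf (.refines _ _)
    (.iSup (Definable.rename h ρ))))))

theorem sup (hA : DefinablyForced A) (hB : DefinablyForced B) :
    DefinablyForced fun v => A v ⊔ B v := by
  have e : ∀ v p, fiber (A v ⊔ B v).1 p = M.cond ψ p ⊓ ⨅ q, M.refines ψ p q ⇨
      ⨆ r, M.refines ψ q r ⊓ (fiber (A v).1 r ⊔ fiber (B v).1 r) := by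
    intro v p
    rw [sup_eq_iSup, fiber_iSup]
    simp only [iSup_bool_eq, cond_true, cond_false]
  simp only [DefinablyForced, e]
  let ρ : Fin (n + 1) → Fin (n + 3) := Fin.cons 0 fun i => i.succ.succ.succ
  exact .inf (.cond _) (.iInf (.himp (.refines _ _) (.iSup (.inf (.refines _ _)
    (.sup (Definable.rename hA ρ) (Definable.rename hB ρ))))))

theorem top : DefinablyForced fun _ : Fin n → D => (⊤ : M.Forced ψ) := by
  have h := const (ψ := ψ) ((Definable.bot (M := M) (n := n)).himp .bot)
  simpa only [himp_self, const_top] using h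

theorem iInf_fin {k : ℕ} {A : Fin k → (Fin n → D) → M.Forced ψ}
    (h : ∀ i, DefinablyForced (A i)) : DefinablyForced fun v => ⨅ i, A i v := by
  induction k with
  | zero => simpa only [iInf_of_empty] using top
  | succ k ih =>
    have e : ∀ v, ⨅ i, A i v = A 0 v ⊓ ⨅ i : Fin k, A i.succ v := fun v =>
      le_antisymm (le_inf (iInf_le _ 0) (le_iInf fun i => iInf_le _ i.succ))
        (le_iInf (Fin.cases inf_le_left fun i => inf_le_right.trans (iInf_le _ i)))
    simp only [e]
    exact inf (h 0) (ih fun i => h i.succ)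

theorem iSup_fin {k : ℕ} {A : (Fin k → D) → (Fin n → D) → M.Forced ψ}
    (h : DefinablyForced fun v : Fin (k + n) → D =>
      A (fun i => v (Fin.castAdd n i)) fun i => v (Fin.natAdd k i)) :
    DefinablyForced fun v => ⨆ w, A w v := by
  induction k generalizing n with
  | zero =>
    have e : ∀ v, ⨆ w, A w v = A ![] v := fun v => by
      rw [iSup_unique]; exact congrFun (congrArg A (Subsingleton.elim _ _)) v
    simp only [e]
    have := h.rename (Fin.cast (Nat.zero_add n))
    convert this using 3 with v
    funext i
    exact congrArg v (Fin.ext (by simp))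
  | succ k ih =>
    have e : ∀ v, ⨆ w, A w v = ⨆ x, ⨆ w : Fin k → D, A (Matrix.vecCons x w) v := fun v =>
      le_antisymm
        (iSup_le fun w => le_iSup_of_le (w 0) (le_iSup_of_le (fun i => w i.succ)
          (congrFun (congrArg A (Matrix.cons_head_tail w).symm) v).le))
        (iSup_le fun x => iSup_le fun w => le_iSup (fun w => A w v) (Matrix.vecCons x w))
    simp only [e]
    refine iSup (ih ?_)
    let ρ : Fin (k + 1 + n) → Fin (k + (n + 1)) := Fin.addCases
      (Fin.cons (Fin.natAdd k 0) fun i => Fin.castAdd (n + 1) i) fun i => Fin.natAdd k i.succ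
    convert h.rename ρ using 3 with v
    · funext i
      refine Fin.cases ?_ (fun i => ?_) i <;> simp [ρ]
    · funext i
      simp [ρ]

end DefinablyForced

end LPT.FrameModel

namespace LPT.FrameModel

open FirstOrder.Language (Term)

universe w x

variable {H : Type w} [Order.Frame H] {D : Type x} {M : FrameModel langHAP H D}
  {ψ : Formula langHAP 2}

/-! ### The forcing model -/

variable (M ψ) in
/-- The conditions that give the value `y` for `f(x)`. -/
def giving (x y : D) : LowerSet (M.Condition ψ) :=
  ⟨{a | a.truth ≤ M.mapsTo a.elt x y}, fun _ _ hba ha => mapsTo_of_refines hba.2 (hba.1.trans ha)⟩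

theorem fiber_giving (x y p : D) : fiber (M.giving ψ x y) p = M.cond ψ p ⊓ M.mapsTo p x y :=
  fiber_eq fun _ _ => Iff.rfl

variable (M ψ) in
/-- The interpretation of the function symbols in the forcing model. -/
def forcingFn : {k : ℕ} → langHAPf.Functions k → (Fin k → D) → D → M.Forced ψ
  | _, .inl F, x, z => const ψ (M.fn F x z)
  | _, .inr .f, x, z => (M.forcing ψ).close (M.giving ψ (x 0) z)

/-- The forcing model, in which `f` is interpreted generically. -/
def forcingModel (hM : M.IsHAPModel) (ψ : Formula langHAP 2) :
    FrameModel langHAPf (M.Forced ψ) D where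
  eq x y := const ψ (M.eq x y)
  eq_refl x := by rw [M.eq_refl, const_top]
  eq_symm x y := const_mono (M.eq_symm x y)
  eq_trans x y z := by
    rw [← const_inf]
    exact const_mono (M.eq_trans x y z)
  fn F x z := M.forcingFn ψ F x z
  fn_congr F x y z w := by
    rcases F with F | F
    · simp only [forcingFn, ← const_iInf, ← const_inf]
      exact const_mono (M.fn_congr F x y z w)
    · cases (show FFunc _ from F)
      rw [← const_iInf, ← const_inf, inf_comm, ← le_himp_iff]
      refine Nucleus.close_le.2 fun a ha => Nucleus.mem_himp.2 fun b hb he => ?_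
      refine Nucleus.le_apply (n := M.forcing ψ) (x := M.giving ψ (y 0) w) ?_
      refine mapsTo_congr (he.trans (inf_le_left.trans (iInf_le _ 0))) (he.trans inf_le_right) ?_
      exact (M.giving ψ (x 0) z).lower hb ha
  fn_unique F x z w := by
    rcases F with F | F
    · simp only [forcingFn, ← const_inf]
      exact const_mono (M.fn_unique F x z w)
    · cases (show FFunc _ from F)
      refine (Nucleus.close_inf _ _).ge.trans (Nucleus.close_le.2 fun a ha => ?_)
      exact hM.mapsTo_unique ha.1 ha.2
  const_total c x := by
    rcases c with c | c
    · simp only [forcingFn, ← const_iSup]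
      rw [M.const_total c x, const_top]
    · cases (show FFunc _ from c)

variable {hM : M.IsHAPModel} {n : ℕ}

/-- Forcing of statements that do not mention `f` is truth. -/
theorem forcingModel_val (t : Tm langHAP n) (v : Fin n → D) (z : D) :
    (forcingModel hM ψ).val
        ((FirstOrder.Language.LHom.sumInl : langHAP →ᴸ langHAPf).onTerm t) v z =
      const ψ (M.val t v z) := by
  induction t generalizing z with
  | var i => rfl
  | func F ts ih =>
    simp only [FirstOrder.Language.LHom.onTerm, val, ih, const_iSup, const_inf, const_iInf]
    rfl

/-- `const` preserves implication and arbitrary meets as well as joins, hence commutes with every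
logical operation. -/
theorem forcingModel_sem (φ : Formula langHAP n) (v : Fin n → D) :
    (forcingModel hM ψ).sem (toF φ) v = const ψ (M.sem φ v) := by
  induction φ with
  | bot => exact const_bot.symm
  | equal s t =>
    refine Eq.trans (iSup_congr fun z => ?_) (const_iSup _).symm
    rw [const_inf, forcingModel_val, forcingModel_val]
  | rel R ts => exact isEmptyElim R
  | and φ ψ ih₁ ih₂ => exact (congr_arg₂ _ (ih₁ v) (ih₂ v)).trans (const_inf _ _).symm
  | or φ ψ ih₁ ih₂ => exact (congr_arg₂ _ (ih₁ v) (ih₂ v)).trans (const_sup _ _).symm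
  | imp φ ψ ih₁ ih₂ => exact (congr_arg₂ _ (ih₁ v) (ih₂ v)).trans (const_himp _ _).symm
  | all φ ih => exact (iInf_congr fun x => ih _).trans (const_iInf _).symm
  | ex φ ih => exact (iSup_congr fun x => ih _).trans (const_iSup _).symm

theorem definablyForced_eq (i j : Fin n) :
    DefinablyForced fun v => (forcingModel hM ψ).eq (v i) (v j) := .const (.eq i j)

theorem definablyForced_fn {k : ℕ} (F : langHAPf.Functions k) (ρ : Fin k → Fin n) (j : Fin n) :
    DefinablyForced fun v => (forcingModel hM ψ).fn F (fun i => v (ρ i)) (v j) := by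
  rcases F with F | F
  · exact .const (.fn F ρ j)
  · cases (show FFunc _ from F)
    simp only [DefinablyForced, forcingModel, forcingFn, fiber_close, fiber_giving]
    exact .inf (.cond _) (.iInf (.himp (.refines _ _) (.iSup (.inf (.refines _ _)
      (.inf (.cond _) (.mapsTo _ _ _))))))

theorem definablyForced_val (t : Tm langHAPf n) {m : ℕ} (ρ : Fin n → Fin m) (j : Fin m) :
    DefinablyForced fun v => (forcingModel hM ψ).val t (fun i => v (ρ i)) (v j) := by
  induction t generalizing m with
  | var i => exact definablyForced_eq _ _
  | func F ts ih =>
    refine .iSup_fin (.inf (.iInf_fin fun i => ?_) ?_)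
    · exact ih i (fun l => Fin.natAdd _ (ρ l)) (Fin.castAdd _ i)
    · exact definablyForced_fn F (fun i => Fin.castAdd _ i) (Fin.natAdd _ j)

theorem definablyForced_sem (φ : Formula langHAPf n) :
    DefinablyForced fun v => (forcingModel hM ψ).sem φ v := by
  induction φ with
  | @bot n =>
    have h := DefinablyForced.const (ψ := ψ) (Definable.bot (M := M) (n := n))
    simp only [const_bot] at h
    exact h
  | equal s t =>
    exact .iSup (.inf (definablyForced_val s Fin.succ 0) (definablyForced_val t Fin.succ 0))
  | rel R ts => exact isEmptyElim R
  | and φ ψ ih₁ ih₂ => exact .inf ih₁ ih₂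
  | or φ ψ ih₁ ih₂ => exact .sup ih₁ ih₂
  | imp φ ψ ih₁ ih₂ => exact .himp ih₁ ih₂
  | all φ ih =>
    refine .iInf ?_
    convert ih using 3 with v
    exact Matrix.cons_head_tail v
  | ex φ ih =>
    refine .iSup ?_
    convert ih using 3 with v
    exact Matrix.cons_head_tail v

/-- Induction holds in the forcing model, since forcing is definable. -/
theorem forcingModel_inductive (χ : Formula langHAPf (n + 1)) (v : Fin n → D) :
    (forcingModel hM ψ).Inductive (L := langHAPf) (Sum.inl HAPFunc.zero)
      (Sum.inl HAPFunc.succ)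
      fun x => (forcingModel hM ψ).sem χ (Matrix.vecCons x v) := by
  intro U h₀ hs x a ha
  refine mem_iff_le_fiber.2 ?_
  let ρ : Fin (n + 2) → Fin (n + 2) := Fin.cons 1 (Fin.cons 0 fun i => i.succ.succ)
  have hA := Definable.rename (definablyForced_sem (hM := hM) (ψ := ψ) χ) ρ
  have e : ∀ x, (fun i : Fin (n + 1) => (Matrix.vecCons x (Matrix.vecCons a.elt v) :
      Fin (n + 2) → D) (ρ i.succ)) = Matrix.vecCons x v := fun x => by
    funext i
    exact Fin.cases rfl (fun i => rfl) i
  -- Induction in `M`, at stage `a.truth`, for the definable predicate that `a.elt` forces χ at `x`;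
  -- the operation `a.elt` is an extra parameter. Base and step are tested on restrictions of `a`.
  have key := hM.induction hA (Matrix.vecCons a.elt v) (u := a.truth) ?_ ?_ x
  · simp only [e] at key
    exact key
  · intro z
    simp only [e]
    have hz : a.restrict (M.isZero z) ∈
        (U ⊓ (forcingModel hM ψ).fn (k := 0) (Sum.inl HAPFunc.zero) ![] z).1 :=
      ⟨U.1.lower (a.restrict_le _) ha, inf_le_right (a := a.truth) (b := M.isZero z)⟩
    exact mem_iff_le_fiber.1 (h₀ z hz)
  · intro x y
    simp only [e]
    let b := a.restrict (fiber ((forcingModel hM ψ).sem χ (Matrix.vecCons x v)).1 a.elt ⊓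
      M.isSucc x y)
    have hb : b ∈ (U ⊓ (forcingModel hM ψ).sem χ (Matrix.vecCons x v) ⊓
        (forcingModel hM ψ).fn (k := 1) (Sum.inl HAPFunc.succ) ![x] y).1 :=
      ⟨⟨U.1.lower (a.restrict_le _) ha,
        mem_iff_le_fiber.2 (inf_le_right.trans inf_le_left)⟩, inf_le_right.trans inf_le_right⟩
    rw [inf_assoc]
    exact mem_iff_le_fiber.1 (hs x y hb)

theorem forcingModel_val_f (i : Fin n) (v : Fin n → D) (z : D) :
    (forcingModel hM ψ).val (fTm (vr i)) v z = (M.forcing ψ).close (M.giving ψ (v i) z) :=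
  val_apply₁_vr (L := langHAPf) (.inr FFunc.f) i v z

/-- Density: a condition either has no value at `x`, and can be refined to give `y`, or it already
gives some `z`, which need not equal `y`. -/
theorem forcingModel_f_den (hM : M.IsHAPModel) (x y : D) :
    const ψ (M.sem ψ ![x, y]) ≤ ⨆ z, (M.forcing ψ).close (M.giving ψ x z) := by
  intro a ha
  refine mem_forced_iff.2 fun b hb => ?_
  have hy := hb.1.trans ha
  have aux : ∀ z c, c ∈ M.giving ψ x z → c ∈ (⨆ z, (M.forcing ψ).close (M.giving ψ x z)).1 :=
    fun z c hc => le_iSup (fun z => (M.forcing ψ).close (M.giving ψ x z)) z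
      (Nucleus.le_apply (n := M.forcing ψ) hc)
  refine sup_elim (b.le_cond.trans (iInf_le _ x)) (fun u hu h => iSup_elim h fun z u' hu' hz => ?_)
    (fun u hu h => iSup_elim h fun z u' hu' hz => ?_)
  · refine iSup_elim (hM.exists_refines_of_isZero ((hu'.trans hu).trans b.le_cond) hz
      ((hu'.trans hu).trans hy)) fun r u'' hu'' hr => ?_
    exact le_iSup₂_of_le (⟨u'', r, hr.trans (inf_le_left.trans (refines_le_right _ _))⟩ :
      M.Condition ψ) ⟨aux y _ (hr.trans inf_le_right), (hu''.trans hu').trans hu,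
        hr.trans inf_le_left⟩ le_rfl
  · exact le_iSup₂_of_le (⟨u', b.elt, (hu'.trans hu).trans b.le_cond⟩ : M.Condition ψ)
      ⟨aux z _ (hz.trans inf_le_left), Condition.mk_le_mk (hu'.trans hu)⟩ le_rfl

theorem forcingModel_f_spec (hM : M.IsHAPModel) (x z : D) :
    (M.forcing ψ).close (M.giving ψ x z) ≤ const ψ (M.sem ψ ![x, z]) :=
  Nucleus.close_le.2 fun a ha => hM.sem_of_mapsTo a.le_cond ha

theorem forcingModel_isModel (hM : M.IsHAPModel) (φ : Formula langHAPf n) (hφ : φ ∈ HAPf ψ n) (v : Fin n → D) :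
    (forcingModel hM ψ).sem φ v = ⊤ := by
  cases hφ with
  | basic h => rw [forcingModel_sem, hM.basic h, const_top]
  | ind χ => exact sem_inductionAxiom _ _ (forcingModel_inductive χ v)
  | f_den x =>
    refine sem_imp_eq_top.2 ?_
    rw [sem_den]
    simp only [forcingModel_val_f]
    refine iSup_le fun y => ?_
    rw [show (![vr x.succ, vr 0] : Fin 2 → Tm langHAPf (n + 1)) =
      fun i => vr ((![x.succ, 0] : Fin 2 → Fin (n + 1)) i) from
        funext fun i => by fin_cases i <;> rfl, sem_rename, forcingModel_sem]
    have e : (fun i => (Matrix.vecCons y v : Fin (n + 1) → D)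
        ((![x.succ, 0] : Fin 2 → Fin (n + 1)) i)) = ![v x, y] :=
      funext fun i => by fin_cases i <;> rfl
    exact (congrArg (fun w => const ψ (M.sem ψ w)) e).trans_le (forcingModel_f_den hM (v x) y)
  | f_spec x =>
    refine sem_imp_eq_top.2 ?_
    rw [sem_den]
    refine iSup_le fun z => ?_
    -- At the stage where `f(x)` has the value `z`, substituting `f(x)` amounts to evaluating at
    -- `z`.
    have h := sem_subst (M := forcingModel hM ψ) (u := (forcingModel hM ψ).val (fTm (vr x)) v z)
      (σ := ![vr x, fTm (vr x)]) (v := v) (w := ![v x, z]) (fun i => by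
        fin_cases i
        · exact le_top.trans ((forcingModel hM ψ).eq_refl _).ge
        · exact le_rfl) (toF ψ)
    refine le_trans (le_inf le_rfl ?_) (h.ge.trans inf_le_right)
    rw [forcingModel_sem, forcingModel_val_f]
    exact forcingModel_f_spec hM _ _

/-- A statement of HAP that is forced is true. -/
theorem eq_top_of_const (hM : M.IsHAPModel) {h : H} (hh : const (M := M) ψ h = ⊤) : h = ⊤ := by
  -- Conditions exist with truth value `⊤`, so it suffices to bound each `cond p` by `h`, using the
  -- condition `p` at its full truth value.
  rw [← top_le_iff, ← hM.iSup_cond (ψ := ψ)]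
  refine iSup_le fun p => ?_
  have : (⟨_, p, le_rfl⟩ : M.Condition ψ) ∈ (const (M := M) ψ h).1 := by rw [hh]; trivial
  exact this

theorem sem_eq_top_of_prf (hM : M.IsHAPModel) {φ : Formula langHAP n} (h : Prf (HAPf ψ) (toF φ))
    (v : Fin n → D) : M.sem φ v = ⊤ := by
  have := soundness (M := forcingModel hM ψ) (fun n φ hφ v => forcingModel_isModel hM φ hφ v) h v
  rw [forcingModel_sem] at this
  exact eq_top_of_const hM this

end LPT.FrameModel

/-! ### The conservation theorem. -/

namespace LPT

/-- Proofs in HAP are proofs in its extension. -/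
theorem Prf.toF {ψ : Formula langHAP 2} {n : ℕ} {φ : Formula langHAP n} (h : Prf HAP φ) :
    Prf (HAPf ψ) (toF φ) := by
  induction h with
  | ax h =>
    refine .ax ?_
    cases h with
    | basic h => exact HAPfAx.basic h
    | ind χ =>
      exact (congrArg (· ∈ HAPf ψ _) (Formula.mapLang_inductionAxiom (L := langHAP) _ HAPFunc.zero
        HAPFunc.succ χ)).mpr (HAPfAx.ind _)
  | id φ => exact .id _
  | mp _ _ ih₁ ih₂ => exact .mp ih₁ ih₂
  | trans _ _ ih₁ ih₂ => exact .trans ih₁ ih₂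
  | and_left φ ψ => exact .and_left _ _
  | and_right φ ψ => exact .and_right _ _
  | and_intro _ _ ih₁ ih₂ => exact .and_intro ih₁ ih₂
  | or_left φ ψ => exact .or_left _ _
  | or_right φ ψ => exact .or_right _ _
  | or_elim _ _ ih₁ ih₂ => exact .or_elim ih₁ ih₂
  | curry _ ih => exact .curry ih
  | uncurry _ ih => exact .uncurry ih
  | bot_elim φ => exact .bot_elim _
  | all_intro _ ih =>
    refine .all_intro ?_
    rw [← Formula.mapLang_shift]
    exact ih
  | all_elim φ t =>
    rw [_root_.toF, Formula.mapLang, Formula.mapLang_inst]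
    exact .all_elim _ _
  | ex_intro φ t =>
    rw [_root_.toF, Formula.mapLang, Formula.mapLang, Formula.mapLang_inst]
    exact .ex_intro _ _
  | ex_elim _ ih =>
    refine .ex_elim ?_
    rw [← Formula.mapLang_shift]
    exact ih
  | eq_refl x => exact .eq_refl _
  | eq_symm x y => exact .eq_symm _ _
  | eq_trans x y z => exact .eq_trans _ _ _
  | eq_func F x y =>
    simp only [_root_.toF, Formula.mapLang, Formula.mapLang_conj, den]
    exact .eq_func (L := langHAPf) (Sum.inl F) _ _
  | eq_rel R x y => exact isEmptyElim R
  | const_den c ts => exact .const_den (L := langHAPf) (Sum.inl c) _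
  | func_strict F ts i => exact .func_strict (L := langHAPf) (Sum.inl F) _ i
  | rel_strict R ts i => exact isEmptyElim R
  | eq_strict s t => exact .eq_strict _ _

theorem termModel_isHAPModel : (termModel HAP HAP.renamable).IsHAPModel := fun n φ hφ v => by
  rw [termModel_sem]
  exact truth_eq_top HAP.renamable (.ax hφ) v

end LPT

/-- The extension of HAP by a function symbol `f` with the axioms `∃ y, ψ(x, y) → f(x) ↓` and
`f(x) ↓ → ψ(x, f(x))` proves exactly the same formulas of the language of HAP as HAP does. -/
theorem mainTheorem10 (ψ : LPT.Formula langHAP 2) (n : ℕ) (φ : LPT.Formula langHAP n) :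
    LPT.Prf (HAPf ψ) (toF φ) ↔ LPT.Prf HAP φ := by
  refine ⟨fun h => ?_, LPT.Prf.toF⟩
  refine LPT.prf_of_truth_eq_top HAP.renamable HAPFunc.zero ?_
  rw [← LPT.termModel_sem (hT := HAP.renamable)]
  exact LPT.FrameModel.sem_eq_top_of_prf LPT.termModel_isHAPModel h _
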